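/- Let $p\ge 1$, $\beta_0\in\mathbb R^p$, $\gamma\in\mathbb R^{d\times p}$, and let $(X_i,Y_i,Z_i)_{i\ge 1}$ be i.i.d. with values in $\mathbb R^p\times\mathbb R\times\mathbb R^d$ and $Y_i=\beta_0^TX_i+\epsilon_i$, $X_i=\gamma^TZ_i+\xi_i$. Write $(X,Y,Z,\epsilon,\xi)$ for a generic observation. Assume $\operatorname{rank}(\mathbb E[ZX^T])=p$; $\mathbb E[Z\epsilon]=0$ and $\mathbb E[Z\xi^T]=0$; $\Sigma_Z:=\mathbb E[ZZ^T]$ is positive definite; $\mathbb E[\epsilon^2\mid Z]=\sigma^2:=\mathbb E[\epsilon^2]$ almost surely; and $\mathbb E\|Z\|^{2k}$, $\mathbb E\|\xi\|^{2k}$, $\mathbb E|\epsilon|^{2k}<\infty$ for some $k>2$. Let $\mathbf X,\mathbf Y,\mathbf Z$ be the matrices with rows $X_i,Y_i,Z_i$, $i\le n$, and $\Pi_{\mathbf Z}=\mathbf Z(\mathbf Z^T\mathbf Z)^{-1}\mathbf Z^T$. Let $\rho_n\ge 0$ be deterministic, and let the Wasserstein DRIVE estimator $\hat\beta^{\mathrm{DRIVE}}_n$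 be a random vector that, almost surely whenever $\mathbf Z^T\mathbf Z$ is invertible, minimizes $$\beta\mapsto\sqrt{\tfrac1n\|\Pi_{\mathbf Z}\mathbf Y-\Pi_{\mathbf Z}\mathbf X\beta\|^2}+\sqrt{\rho_n(\|\beta\|^2+1)}.$$ Suppose $\rho_n\to\rho\le\lambda_p(\gamma^T\Sigma_Z\gamma)$, the smallest eigenvalue of $\gamma^T\Sigma_Z\gamma$. Then for every $z\in\mathbb R^d$ the function $$\delta\mapsto\sqrt{(z+\Sigma_Z\gamma\delta)^T\Sigma_Z^{-1}(z+\Sigma_Z\gamma\delta)}+\frac{\sqrt\rho\,\beta_0^T\delta}{\sqrt{1+\|\beta_0\|^2}},\qquad\delta\in\mathbb R^p,$$ has a unique minimizer, which depends measurably on $z$, and $$\sqrt n(\hat\beta^{\mathrm{DRIVE}}_n-\beta_0)\to_d\arg\min_\delta\left\{\sqrt{(\mathcal Z+\Sigma_Z\gamma\delta)^T\Sigma_Z^{-1}(\mathcal Z+\Sigma_Z\gamma\delta)}+\frac{\sqrt\rho\,\beta_0^T\delta}{\sqrt{1+\|\beta_0\|^2}}\right\},\qquad \mathcal Z\sim\mathcal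 N(0,\sigma^2\Sigma_Z).$$ In particular, if $\rho_n\to0$ at any rate, then $\sqrt n(\hat\beta^{\mathrm{DRIVE}}_n-\beta_0)\to_d\mathcal N(0,\sigma^2(\gamma^T\Sigma_Z\gamma)^{-1})$, which is the limit law of $\sqrt n(\hat\beta^{\mathrm{TSLS}}_n-\beta_0)$ for the two stage least squares estimator $\hat\beta^{\mathrm{TSLS}}_n=(\mathbf X^T\Pi_{\mathbf Z}\mathbf X)^{-1}\mathbf X^T\Pi_{\mathbf Z}\mathbf Y$. -/

import Mathlib

open MeasureTheory ProbabilityTheory Filter Topology Matrix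

/-- The matrix whose `i`-th row is the observation `W i ω`, for the first `n` observations. -/
def dataMatrix {Ω : Type*} {m : ℕ} (W : ℕ → Ω → EuclideanSpace ℝ (Fin m)) (n : ℕ) (ω : Ω) :
    Matrix (Fin n) (Fin m) ℝ :=
  Matrix.of fun i j => W i ω j

/-- The vector of the first `n` scalar observations. -/
def dataVector {Ω : Type*} (Y : ℕ → Ω → ℝ) (n : ℕ) (ω : Ω) : Fin n → ℝ :=
  fun i => Y i ω

/-- `Π_Z = Z (Zᵀ Z)⁻¹ Zᵀ`, for a data matrix `Z` with `Zᵀ Z` invertible. -/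
noncomputable def projMatrix {n d : ℕ} (Z : Matrix (Fin n) (Fin d) ℝ) :
    Matrix (Fin n) (Fin n) ℝ :=
  Z * (Zᵀ * Z)⁻¹ * Zᵀ

/-- The square root ridge form of the Wasserstein DRIVE objective,
`√((1/n) ‖Π_Z Y - Π_Z X β‖²) + √(ρ (‖β‖² + 1))`. -/
noncomputable def driveObjective {n p d : ℕ} (X : Matrix (Fin n) (Fin p) ℝ) (Y : Fin n → ℝ)
    (Z : Matrix (Fin n) (Fin d) ℝ) (ρ : ℝ) (β : EuclideanSpace ℝ (Fin p)) : ℝ :=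
  √((1 / (n : ℝ)) * ∑ i, ((projMatrix Z *ᵥ Y - projMatrix Z *ᵥ (X *ᵥ β.ofLp)) i) ^ 2)
    + √(ρ * (‖β‖ ^ 2 + 1))

/-- `β` solves the Wasserstein DRIVE problem with data `X, Y, Z` and parameter `ρ`. -/
def IsDriveEstimate {n p d : ℕ} (X : Matrix (Fin n) (Fin p) ℝ) (Y : Fin n → ℝ)
    (Z : Matrix (Fin n) (Fin d) ℝ) (ρ : ℝ) (β : EuclideanSpace ℝ (Fin p)) : Prop :=
  ∀ b : EuclideanSpace ℝ (Fin p), driveObjective X Y Z ρ β ≤ driveObjective X Y Z ρ b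

/-- The two stage least squares estimate `(Xᵀ Π_Z X)⁻¹ Xᵀ Π_Z Y`. -/
noncomputable def tslsEstimate {n p d : ℕ} (X : Matrix (Fin n) (Fin p) ℝ) (Y : Fin n → ℝ)
    (Z : Matrix (Fin n) (Fin d) ℝ) : EuclideanSpace ℝ (Fin p) :=
  WithLp.toLp 2 ((Xᵀ * projMatrix Z * X)⁻¹ *ᵥ ((Xᵀ * projMatrix Z) *ᵥ Y))

/-- The second moment matrix `E[U Vᵀ]` of two random vectors. -/
noncomputable def momentMatrix {Ω : Type*} [MeasurableSpace Ω] {a b : ℕ} (P : Measure Ω)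
    (U : Ω → EuclideanSpace ℝ (Fin a)) (V : Ω → EuclideanSpace ℝ (Fin b)) :
    Matrix (Fin a) (Fin b) ℝ :=
  Matrix.of fun i j => ∫ ω, U ω i * V ω j ∂P

theorem isHermitian_firstStage {Ω : Type*} [MeasurableSpace Ω] {p d : ℕ} (P : Measure Ω)
    (Z : Ω → EuclideanSpace ℝ (Fin d)) (γ : Matrix (Fin d) (Fin p) ℝ) :
    (γᵀ * momentMatrix P Z Z * γ).IsHermitian := by
  have h : (momentMatrix P Z Z)ᵀ = momentMatrix P Z Z := by
    ext i j
    simp [momentMatrix, mul_comm]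
  rw [Matrix.IsHermitian, Matrix.conjTranspose_eq_transpose_of_trivial]
  simp [Matrix.transpose_mul, h, Matrix.mul_assoc]

/-- `λ_p(M)`, the `p`-th largest (that is, the smallest) eigenvalue of a symmetric `p × p`
matrix; `eigenvalues₀` lists the eigenvalues with multiplicity in decreasing order. -/
noncomputable def lambdaLast {p : ℕ} (hp : 0 < p) {M : Matrix (Fin p) (Fin p) ℝ}
    (hM : M.IsHermitian) : ℝ :=
  hM.eigenvalues₀ ⟨p - 1, by rw [Fintype.card_fin]; omega⟩

/-- An i.i.d. sample from the linear instrumental variables model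
`Y = β₀ᵀ X + ε`, `X = γᵀ Z + ξ`, with relevant, exogenous and not perfectly collinear
instruments, structural error `ε` homoskedastic given `Z`, and finite moments of some
order `2k`, `k > 2`. -/
structure IsLinearIVSample {Ω : Type*} [MeasurableSpace Ω] {p d : ℕ} (P : Measure Ω)
    (β₀ : EuclideanSpace ℝ (Fin p)) (γ : Matrix (Fin d) (Fin p) ℝ)
    (X : ℕ → Ω → EuclideanSpace ℝ (Fin p)) (Y : ℕ → Ω → ℝ)
    (Z : ℕ → Ω → EuclideanSpace ℝ (Fin d))
    (ε : ℕ → Ω → ℝ) (ξ : ℕ → Ω → EuclideanSpace ℝ (Fin p)) : Prop where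
  measurable_X : ∀ i, Measurable (X i)
  measurable_Y : ∀ i, Measurable (Y i)
  measurable_Z : ∀ i, Measurable (Z i)
  outcome : ∀ i ω, Y i ω = β₀.ofLp ⬝ᵥ (X i ω).ofLp + ε i ω
  first_stage : ∀ i ω, (X i ω).ofLp = γᵀ *ᵥ (Z i ω).ofLp + (ξ i ω).ofLp
  indep : iIndepFun (fun i ω => (X i ω, Y i ω, Z i ω)) P
  ident : ∀ i, IdentDistrib (fun ω => (X i ω, Y i ω, Z i ω))
    (fun ω => (X 0 ω, Y 0 ω, Z 0 ω)) P P
  moments : ∃ k : ℝ, 2 < k ∧ MemLp (Z 0) (ENNReal.ofReal (2 * k)) P ∧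
    MemLp (ξ 0) (ENNReal.ofReal (2 * k)) P ∧ MemLp (ε 0) (ENNReal.ofReal (2 * k)) P
  relevance : (momentMatrix P (Z 0) (X 0)).rank = p
  exogenous_ε : ∀ j, ∫ ω, Z 0 ω j * ε 0 ω ∂P = 0
  exogenous_ξ : momentMatrix P (Z 0) (ξ 0) = 0
  not_collinear : (momentMatrix P (Z 0) (Z 0)).PosDef
  homoskedastic : condExp (MeasurableSpace.comap (Z 0) inferInstance) P
    (fun ω => ε 0 ω ^ 2) =ᵐ[P] fun _ => ∫ ω, ε 0 ω ^ 2 ∂P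

/-- The limiting objective
`√((z + Σγδ)ᵀ Σ⁻¹ (z + Σγδ)) + (√ρ / √(1 + ‖β₀‖²)) β₀ᵀδ`. -/
noncomputable def limitObjective {p d : ℕ} (β₀ : EuclideanSpace ℝ (Fin p))
    (γ : Matrix (Fin d) (Fin p) ℝ) (S : Matrix (Fin d) (Fin d) ℝ) (ρ : ℝ)
    (z : EuclideanSpace ℝ (Fin d)) (δ : EuclideanSpace ℝ (Fin p)) : ℝ :=
  √((z.ofLp + (S * γ) *ᵥ δ.ofLp) ⬝ᵥ (S⁻¹ *ᵥ (z.ofLp + (S * γ) *ᵥ δ.ofLp)))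
    + √ρ / √(1 + ‖β₀‖ ^ 2) * (β₀.ofLp ⬝ᵥ δ.ofLp)

/-! With `t = 1/√n`, the objective at `β₀ + t • δ` equals, up to an additive constant, `t` times a
function of `δ`. That function depends on the data only through `n⁻¹ZᵀZ`, `n⁻¹ZᵀX` and the score
`-n^(-1/2) Zᵀε`, and it is jointly continuous down to `t = 0`, where it becomes the limiting
objective (`driveObjective_add_smul`, `continuous_localObjective`). The matrices converge almost
surely by the law of large numbers. The score converges in law to `N(0, σ²Σ)` by the central limit
theorem, homoskedasticity giving this covariance.

The limiting objective has an explicit minimizer `m z`, unique and continuous in `z`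
(`exists_continuous_minimizer`). Strict domination of the linear term survives at `ρ = λ_p` because
`‖β₀‖² / (1 + ‖β₀‖²) < 1` (`sq_penalty_lt`).

By convexity, a value at `m z` below all values on a sphere around it traps every minimizer inside.
Compactness makes this comparison stable under perturbation, uniformly over bounded scores
(`eventually_localObjective_lt`). Tightness of the scores then makes `√n(βhat - β₀) - m(score)` tend
to 0 in probability, and continuous mapping with Slutsky concludes. TSLS is DRIVE with zero penalty,
for which `m` is linear. -/

/-! ### Quadratic forms and the minimizer of the limiting objective. -/

section quadratic

variable {p d : ℕ}

/-- In an eigenbasis, `M - λ_p` is diagonal with entries `λ_i - λ_p ≥ 0`, hence positive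
semidefinite. -/
theorem Matrix.IsHermitian.lambdaLast_mul_le (hp : 0 < p) {M : Matrix (Fin p) (Fin p) ℝ}
    (hM : M.IsHermitian) (h : Fin p → ℝ) :
    lambdaLast hp hM * (h ⬝ᵥ h) ≤ h ⬝ᵥ (M *ᵥ h) := by
  have hmin : ∀ i, lambdaLast hp hM ≤ hM.eigenvalues i := by
    intro i
    apply hM.eigenvalues₀_antitone
    rw [Fin.le_def]
    have := ((Fintype.equivOfCardEq (Fintype.card_fin (Fintype.card (Fin p)))).symm i).isLt
    simp only [Fintype.card_fin] at this ⊢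
    omega
  have hdiag : (Matrix.diagonal (fun i => hM.eigenvalues i - lambdaLast hp hM)).PosSemidef :=
    Matrix.PosSemidef.diagonal fun i => sub_nonneg.2 (hmin i)
  have hpsd : (M - lambdaLast hp hM • (1 : Matrix (Fin p) (Fin p) ℝ)).PosSemidef := by
    have hU := hdiag.mul_mul_conjTranspose_same (hM.eigenvectorUnitary : Matrix (Fin p) (Fin p) ℝ)
    convert hU using 1
    have hspec := hM.spectral_theorem
    have h1 : (hM.eigenvectorUnitary : Matrix (Fin p) (Fin p) ℝ)
        * (hM.eigenvectorUnitary : Matrix (Fin p) (Fin p) ℝ)ᴴ = 1 :=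
      Unitary.coe_mul_star_self hM.eigenvectorUnitary
    have h2 : (Matrix.diagonal fun i => hM.eigenvalues i - lambdaLast hp hM)
        = Matrix.diagonal hM.eigenvalues - lambdaLast hp hM • (1 : Matrix (Fin p) (Fin p) ℝ) := by
      ext i j
      by_cases hij : i = j <;> simp [hij]
    rw [h2, Matrix.mul_sub, Matrix.sub_mul, Matrix.mul_smul, Matrix.mul_one, Matrix.smul_mul, h1]
    congr 1
  have := hpsd.dotProduct_mulVec_nonneg h
  simp only [star_trivial, Matrix.sub_mulVec, Matrix.smul_mulVec, Matrix.one_mulVec,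
    dotProduct_sub, dotProduct_smul, smul_eq_mul] at this
  linarith

theorem dotProduct_mulVec_symm {M : Matrix (Fin p) (Fin p) ℝ} (hM : Mᵀ = M) (u v : Fin p → ℝ) :
    u ⬝ᵥ (M *ᵥ v) = v ⬝ᵥ (M *ᵥ u) := by
  rw [Matrix.dotProduct_mulVec, ← Matrix.mulVec_transpose, hM, dotProduct_comm]

theorem dotProduct_mulVec_add_self {M : Matrix (Fin p) (Fin p) ℝ} (hM : Mᵀ = M)
    (u v : Fin p → ℝ) :
    (u + v) ⬝ᵥ (M *ᵥ (u + v)) = u ⬝ᵥ (M *ᵥ u) + 2 * (v ⬝ᵥ (M *ᵥ u)) + v ⬝ᵥ (M *ᵥ v) := by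
  simp only [Matrix.mulVec_add, dotProduct_add, add_dotProduct]
  rw [dotProduct_mulVec_symm hM u v]
  ring

theorem Matrix.PosDef.dotProduct_pos {M : Matrix (Fin p) (Fin p) ℝ} (hM : M.PosDef)
    {h : Fin p → ℝ} (hh : h ≠ 0) : 0 < h ⬝ᵥ (M *ᵥ h) := by
  simpa using hM.dotProduct_mulVec_pos hh

theorem Matrix.PosSemidef.dotProduct_nonneg {M : Matrix (Fin p) (Fin p) ℝ} (hM : M.PosSemidef)
    (h : Fin p → ℝ) : 0 ≤ h ⬝ᵥ (M *ᵥ h) := by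
  simpa using hM.dotProduct_mulVec_nonneg h

theorem Matrix.PosDef.transpose_eq {M : Matrix (Fin p) (Fin p) ℝ} (hM : M.PosDef) : Mᵀ = M := by
  have := hM.isHermitian
  rwa [Matrix.IsHermitian, Matrix.conjTranspose_eq_transpose_of_trivial] at this

/-- `√((z + Sγδ)ᵀ S⁻¹ (z + Sγδ)) + cᵀδ` has a unique minimizer, continuous in `z`, as soon as the
linear term is strictly dominated by the quadratic form `γᵀ S γ`. -/
theorem exists_continuous_minimizer {S : Matrix (Fin d) (Fin d) ℝ} (hS : S.PosDef)
    {γ : Matrix (Fin d) (Fin p) ℝ} (hA : (γᵀ * S * γ).PosDef) {c : Fin p → ℝ}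
    (hc : ∀ h, h ≠ 0 → (c ⬝ᵥ h) ^ 2 < h ⬝ᵥ ((γᵀ * S * γ) *ᵥ h)) :
    ∃ m : EuclideanSpace ℝ (Fin d) → EuclideanSpace ℝ (Fin p), Continuous m ∧
      (∀ z δ, δ ≠ m z →
        √((z.ofLp + (S * γ) *ᵥ (m z).ofLp) ⬝ᵥ (S⁻¹ *ᵥ (z.ofLp + (S * γ) *ᵥ (m z).ofLp)))
            + c ⬝ᵥ (m z).ofLp
          < √((z.ofLp + (S * γ) *ᵥ δ.ofLp) ⬝ᵥ (S⁻¹ *ᵥ (z.ofLp + (S * γ) *ᵥ δ.ofLp)))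
            + c ⬝ᵥ δ.ofLp) ∧
      (c = 0 → ∀ z, m z = WithLp.toLp 2 (-((γᵀ * S * γ)⁻¹ * γᵀ) *ᵥ z.ofLp)) := by
  set A := γᵀ * S * γ with hAdef
  have hAdet : IsUnit A.det := (Matrix.isUnit_iff_isUnit_det _).1 hA.isUnit
  have hSdet : IsUnit S.det := (Matrix.isUnit_iff_isUnit_det _).1 hS.isUnit
  have hAt : Aᵀ = A := hA.transpose_eq
  have hSt : Sᵀ = S := hS.transpose_eq
  have hSit : (S⁻¹)ᵀ = S⁻¹ := by rw [Matrix.transpose_nonsing_inv, hSt]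
  set a := A⁻¹ *ᵥ c with ha
  have hAa : A *ᵥ a = c := by
    rw [ha, Matrix.mulVec_mulVec, Matrix.mul_nonsing_inv _ hAdet, Matrix.one_mulVec]
  set κ := c ⬝ᵥ a with hκ
  have haAa : a ⬝ᵥ (A *ᵥ a) = κ := by rw [hAa, dotProduct_comm]
  -- Taking `h = a` in `hc` gives `κ² < κ`.
  have hκ1 : κ < 1 := by
    by_cases h0 : a = 0
    · simp [hκ, h0]
    · have h1 := hc a h0
      rw [haAa] at h1
      have h2 := hA.dotProduct_pos h0
      rw [haAa] at h2
      nlinarith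
  -- `δs z` minimizes the quadratic form alone. Its residual `e z` is killed by `γᵀ`, so the form at
  -- `δs z + u` splits as its value at `e z` plus `uᵀAu`.
  set δs : (Fin d → ℝ) → (Fin p → ℝ) := fun z => -(A⁻¹ * γᵀ) *ᵥ z with hδs
  set e : (Fin d → ℝ) → (Fin d → ℝ) := fun z => z + (S * γ) *ᵥ δs z with he
  -- Along `u = -s • a` the objective is `√(q + s²κ) - sκ` up to a constant, with `q` the form at `e
  -- z`. Stationarity for `κ ≠ 0` reads `s² = q + s²κ`, so `s = √(q / (1 - κ)) = T`, which is also
  -- the value of the root there.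
  set T : (Fin d → ℝ) → ℝ := fun z => √(e z ⬝ᵥ (S⁻¹ *ᵥ e z)) / √(1 - κ) with hT
  have hort : ∀ z, γᵀ *ᵥ e z = 0 := by
    intro z
    simp only [he, hδs, Matrix.mulVec_add, Matrix.mulVec_mulVec, Matrix.neg_mulVec,
      Matrix.mulVec_neg]
    have : γᵀ * (S * γ) * (A⁻¹ * γᵀ) = γᵀ := by
      rw [← Matrix.mul_assoc γᵀ S γ, ← hAdef, ← Matrix.mul_assoc, Matrix.mul_nonsing_inv _ hAdet,
        Matrix.one_mul]
    rw [← Matrix.mul_assoc, this, add_neg_cancel]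
  have hquad : ∀ z u, (e z + (S * γ) *ᵥ u) ⬝ᵥ (S⁻¹ *ᵥ (e z + (S * γ) *ᵥ u))
      = e z ⬝ᵥ (S⁻¹ *ᵥ e z) + u ⬝ᵥ (A *ᵥ u) := by
    intro z u
    rw [dotProduct_mulVec_add_self hSit]
    have h1 : S⁻¹ *ᵥ ((S * γ) *ᵥ u) = γ *ᵥ u := by
      rw [Matrix.mulVec_mulVec, ← Matrix.mul_assoc, Matrix.nonsing_inv_mul _ hSdet, Matrix.one_mul]
    have h2 : ((S * γ) *ᵥ u) ⬝ᵥ (S⁻¹ *ᵥ e z) = 0 := by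
      rw [dotProduct_mulVec_symm hSit, h1, Matrix.dotProduct_mulVec, ← Matrix.mulVec_transpose,
        hort, zero_dotProduct]
    have h3 : ((S * γ) *ᵥ u) ⬝ᵥ (S⁻¹ *ᵥ ((S * γ) *ᵥ u)) = u ⬝ᵥ (A *ᵥ u) := by
      rw [h1, hAdef, Matrix.mul_assoc, ← Matrix.mulVec_mulVec u γᵀ, Matrix.dotProduct_mulVec u γᵀ,
        Matrix.vecMul_transpose, dotProduct_comm]
    rw [h2, h3]; ring
  have hT0 : ∀ z, 0 ≤ T z := fun z => by positivity
  have hTsq : ∀ z, e z ⬝ᵥ (S⁻¹ *ᵥ e z) = T z ^ 2 * (1 - κ) := by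
    intro z
    have h1 : 0 ≤ e z ⬝ᵥ (S⁻¹ *ᵥ e z) := hS.inv.posSemidef.dotProduct_nonneg _
    have h2 : 0 < 1 - κ := by linarith
    simp only [hT, div_pow, Real.sq_sqrt h1, Real.sq_sqrt h2.le]
    field_simp
  have hval : ∀ z h, (z + (S * γ) *ᵥ (δs z - T z • a + h)) ⬝ᵥ
      (S⁻¹ *ᵥ (z + (S * γ) *ᵥ (δs z - T z • a + h)))
        = h ⬝ᵥ (A *ᵥ h) - 2 * T z * (c ⬝ᵥ h) + T z ^ 2 := by
    intro z h
    have h1 : z + (S * γ) *ᵥ (δs z - T z • a + h) = e z + (S * γ) *ᵥ (-(T z • a) + h) := by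
      simp only [he, Matrix.mulVec_add, Matrix.mulVec_sub, Matrix.mulVec_neg]
      abel
    rw [h1, hquad, hTsq, dotProduct_mulVec_add_self hAt]
    simp only [Matrix.mulVec_neg, Matrix.mulVec_smul, hAa, dotProduct_neg, neg_dotProduct,
      dotProduct_smul, smul_dotProduct, smul_eq_mul]
    rw [dotProduct_comm a c, dotProduct_comm h c, ← hκ]
    ring
  refine ⟨fun z => WithLp.toLp 2 (δs z.ofLp - T z.ofLp • a), ?_, ?_, ?_⟩
  · have h1 : Continuous δs := by
      simp only [hδs]
      exact continuous_const.matrix_mulVec continuous_id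
    have h2 : Continuous e := by
      simp only [he]
      exact continuous_id.add (continuous_const.matrix_mulVec h1)
    have h3 : Continuous T := by
      simp only [hT]
      exact (h2.dotProduct (continuous_const.matrix_mulVec h2)).sqrt.div_const _
    have h4 : Continuous fun z => δs z - T z • a := h1.sub (h3.smul continuous_const)
    exact (PiLp.continuous_toLp 2 _).comp (h4.comp (PiLp.continuous_ofLp 2 _))
  · intro z δ hδ
    set v := δs z.ofLp - T z.ofLp • a with hv
    obtain ⟨h, hh⟩ : ∃ h, δ.ofLp = v + h := ⟨δ.ofLp - v, by abel⟩
    have hh0 : h ≠ 0 := by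
      rintro rfl
      apply hδ
      rw [add_zero] at hh
      show δ = WithLp.toLp 2 v
      rw [← hh]
    have e0 := hval z.ofLp 0
    simp only [← hv, add_zero, dotProduct_zero, Matrix.mulVec_zero, mul_zero, sub_zero,
      zero_add] at e0
    rw [hh, e0, hv, hval, ← hv, Real.sqrt_sq (hT0 _), dotProduct_add]
    have := hc h hh0
    -- `(T - c·h)²` differs from the radicand only in having `(c·h)²` where the latter has `hᵀAh`.
    have : T z.ofLp - c ⬝ᵥ h < √(h ⬝ᵥ (A *ᵥ h) - 2 * T z.ofLp * (c ⬝ᵥ h) + T z.ofLp ^ 2) :=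
      Real.lt_sqrt_of_sq_lt (by nlinarith)
    linarith
  · intro h0 z
    simp [ha, h0, hδs]

end quadratic

/-! ### The DRIVE objective: rescaling, convexity, and the case of no penalty. -/

section localObjective

variable {n p d : ℕ}

/-- The DRIVE objective around `β₀`, on the scale `t = 1/√n`; it extends continuously to `t = 0`,
where it is the limiting objective. -/
noncomputable def localObjective (β₀ : EuclideanSpace ℝ (Fin p)) (B : Matrix (Fin d) (Fin d) ℝ)
    (G : Matrix (Fin d) (Fin p) ℝ) (r t : ℝ) (z : EuclideanSpace ℝ (Fin d))
    (δ : EuclideanSpace ℝ (Fin p)) : ℝ :=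
  √((z.ofLp + G *ᵥ δ.ofLp) ⬝ᵥ (B *ᵥ (z.ofLp + G *ᵥ δ.ofLp)))
    + √r * ((2 * (β₀.ofLp ⬝ᵥ δ.ofLp) + t * ‖δ‖ ^ 2)
      / (√(‖β₀ + t • δ‖ ^ 2 + 1) + √(‖β₀‖ ^ 2 + 1)))

theorem localObjective_zero (β₀ : EuclideanSpace ℝ (Fin p)) (γ : Matrix (Fin d) (Fin p) ℝ)
    (S : Matrix (Fin d) (Fin d) ℝ) (r : ℝ) (z : EuclideanSpace ℝ (Fin d))
    (δ : EuclideanSpace ℝ (Fin p)) :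
    localObjective β₀ S⁻¹ (S * γ) r 0 z δ = limitObjective β₀ γ S r z δ := by
  have : 0 < √(‖β₀‖ ^ 2 + 1) := by positivity
  simp only [localObjective, limitObjective, zero_smul, add_zero, zero_mul]
  rw [add_comm 1 (‖β₀‖ ^ 2)]
  congr 1
  field_simp
  ring

theorem continuous_localObjective (β₀ : EuclideanSpace ℝ (Fin p)) :
    Continuous fun x : (Matrix (Fin d) (Fin d) ℝ × Matrix (Fin d) (Fin p) ℝ × ℝ × ℝ)
        × (EuclideanSpace ℝ (Fin d) × EuclideanSpace ℝ (Fin p)) =>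
      localObjective β₀ x.1.1 x.1.2.1 x.1.2.2.1 x.1.2.2.2 x.2.1 x.2.2 := by
  have h1 : Continuous fun x : (Matrix (Fin d) (Fin d) ℝ × Matrix (Fin d) (Fin p) ℝ × ℝ × ℝ)
        × (EuclideanSpace ℝ (Fin d) × EuclideanSpace ℝ (Fin p)) =>
      x.2.1.ofLp + x.1.2.1 *ᵥ x.2.2.ofLp := by
    have ha : Continuous fun x : (Matrix (Fin d) (Fin d) ℝ × Matrix (Fin d) (Fin p) ℝ × ℝ × ℝ)
        × (EuclideanSpace ℝ (Fin d) × EuclideanSpace ℝ (Fin p)) => x.1.2.1 := by fun_prop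
    have hb : Continuous fun x : (Matrix (Fin d) (Fin d) ℝ × Matrix (Fin d) (Fin p) ℝ × ℝ × ℝ)
        × (EuclideanSpace ℝ (Fin d) × EuclideanSpace ℝ (Fin p)) => x.2.2.ofLp := by fun_prop
    have hc : Continuous fun x : (Matrix (Fin d) (Fin d) ℝ × Matrix (Fin d) (Fin p) ℝ × ℝ × ℝ)
        × (EuclideanSpace ℝ (Fin d) × EuclideanSpace ℝ (Fin p)) => x.2.1.ofLp := by fun_prop
    exact hc.add (ha.matrix_mulVec hb)
  have hB : Continuous fun x : (Matrix (Fin d) (Fin d) ℝ × Matrix (Fin d) (Fin p) ℝ × ℝ × ℝ)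
        × (EuclideanSpace ℝ (Fin d) × EuclideanSpace ℝ (Fin p)) => x.1.1 := by fun_prop
  have hd : Continuous fun x : (Matrix (Fin d) (Fin d) ℝ × Matrix (Fin d) (Fin p) ℝ × ℝ × ℝ)
        × (EuclideanSpace ℝ (Fin d) × EuclideanSpace ℝ (Fin p)) =>
      β₀.ofLp ⬝ᵥ x.2.2.ofLp :=
    continuous_const.dotProduct (by fun_prop)
  refine (h1.dotProduct (hB.matrix_mulVec h1)).sqrt.add (Continuous.mul (by fun_prop) ?_)
  refine Continuous.div (by fun_prop) (by fun_prop) fun x => ?_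
  positivity

theorem projMatrix_transpose (Z : Matrix (Fin n) (Fin d) ℝ) : (projMatrix Z)ᵀ = projMatrix Z := by
  simp only [projMatrix, Matrix.transpose_mul, Matrix.transpose_nonsing_inv,
    Matrix.transpose_transpose, Matrix.mul_assoc]

theorem projMatrix_mul_self {Z : Matrix (Fin n) (Fin d) ℝ} (hZ : IsUnit (Zᵀ * Z).det) :
    projMatrix Z * projMatrix Z = projMatrix Z := by
  simp only [projMatrix]
  rw [Matrix.mul_assoc (Z * (Zᵀ * Z)⁻¹) Zᵀ, ← Matrix.mul_assoc Zᵀ (Z * _) Zᵀ, ← Matrix.mul_assoc Zᵀ Z,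
    Matrix.mul_nonsing_inv _ hZ, Matrix.one_mul]

/-- Since `Π_Z` is a symmetric idempotent, the `n`-dimensional residual enters only through the
`d`-vector `Zᵀv`, to which limit theorems apply. -/
theorem projMatrix_mulVec_dotProduct_self {Z : Matrix (Fin n) (Fin d) ℝ}
    (hZ : IsUnit (Zᵀ * Z).det) (v : Fin n → ℝ) :
    (projMatrix Z *ᵥ v) ⬝ᵥ (projMatrix Z *ᵥ v) = (Zᵀ *ᵥ v) ⬝ᵥ ((Zᵀ * Z)⁻¹ *ᵥ (Zᵀ *ᵥ v)) := by
  rw [Matrix.dotProduct_mulVec, Matrix.vecMul_mulVec, projMatrix_transpose, projMatrix_mul_self hZ,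
    ← Matrix.dotProduct_mulVec, projMatrix, Matrix.mulVec_transpose Z v,
    ← Matrix.dotProduct_mulVec v Z, ← Matrix.mulVec_transpose Z v, Matrix.mulVec_mulVec,
    Matrix.mulVec_mulVec, Matrix.mul_assoc]

theorem driveObjective_eq (X : Matrix (Fin n) (Fin p) ℝ) (Y : Fin n → ℝ)
    (Z : Matrix (Fin n) (Fin d) ℝ) (ρ : ℝ) (β : EuclideanSpace ℝ (Fin p)) :
    driveObjective X Y Z ρ β
      = √((1 / (n : ℝ)) * ((projMatrix Z *ᵥ (Y - X *ᵥ β.ofLp)) ⬝ᵥ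
          (projMatrix Z *ᵥ (Y - X *ᵥ β.ofLp)))) + √(ρ * (‖β‖ ^ 2 + 1)) := by
  simp only [driveObjective, dotProduct, Matrix.mulVec_sub, sq]

theorem Matrix.inv_inv_smul {A : Matrix (Fin n) (Fin n) ℝ} (hA : IsUnit A.det) {c : ℝ}
    (hc : c ≠ 0) : (c⁻¹ • A)⁻¹ = c • A⁻¹ := by
  apply Matrix.inv_eq_right_inv
  rw [Matrix.smul_mul, Matrix.mul_smul, Matrix.mul_nonsing_inv _ hA, smul_smul,
    inv_mul_cancel₀ hc, one_smul]

/-- An exact identity rather than an expansion: no remainder has to be controlled, and minimization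
over `δ` is unaffected by the positive factor and the constant. -/
theorem driveObjective_add_smul (hn : 0 < n) {X : Matrix (Fin n) (Fin p) ℝ} {Y e : Fin n → ℝ}
    {Z : Matrix (Fin n) (Fin d) ℝ} (hZ : IsUnit (Zᵀ * Z).det) {ρ : ℝ} (hρ : 0 ≤ ρ)
    {β₀ : EuclideanSpace ℝ (Fin p)} (hY : Y = X *ᵥ β₀.ofLp + e) (δ : EuclideanSpace ℝ (Fin p)) :
    driveObjective X Y Z ρ (β₀ + (√(n : ℝ))⁻¹ • δ)
      = (√(n : ℝ))⁻¹ * localObjective β₀ ((n : ℝ)⁻¹ • (Zᵀ * Z))⁻¹ ((n : ℝ)⁻¹ • (Zᵀ * X)) ρ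
          (√(n : ℝ))⁻¹ (WithLp.toLp 2 (-(√(n : ℝ))⁻¹ • (Zᵀ *ᵥ e))) δ
        + √(ρ * (‖β₀‖ ^ 2 + 1)) := by
  have hn' : (0 : ℝ) < n := by exact_mod_cast hn
  set t := (√(n : ℝ))⁻¹ with ht
  have ht0 : 0 < t := by positivity
  have htn : t ^ 2 = (n : ℝ)⁻¹ := by rw [ht, inv_pow, Real.sq_sqrt hn'.le]
  have hres : Zᵀ *ᵥ (Y - X *ᵥ (β₀ + t • δ).ofLp)
      = -t⁻¹ • (-t • (Zᵀ *ᵥ e) + ((n : ℝ)⁻¹ • (Zᵀ * X)) *ᵥ δ.ofLp) := by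
    rw [hY, ← htn]
    simp only [WithLp.ofLp_add, WithLp.ofLp_smul, Matrix.mulVec_add, Matrix.mulVec_sub,
      Matrix.mulVec_smul, Matrix.smul_mulVec, Matrix.mulVec_mulVec, smul_add, smul_smul]
    have h1 : -t⁻¹ * -t = 1 := by field_simp
    have h2 : -t⁻¹ * t ^ 2 = -t := by field_simp
    rw [h1, h2, one_smul, neg_smul]
    abel
  have hinv : (Zᵀ * Z)⁻¹ = t ^ 2 • ((n : ℝ)⁻¹ • (Zᵀ * Z))⁻¹ := by
    rw [Matrix.inv_inv_smul hZ hn'.ne', smul_smul, htn, inv_mul_cancel₀ hn'.ne', one_smul]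
  rw [driveObjective_eq, projMatrix_mulVec_dotProduct_self hZ, hres, hinv, localObjective]
  generalize ((n : ℝ)⁻¹ • (Zᵀ * Z))⁻¹ = B
  generalize (n : ℝ)⁻¹ • (Zᵀ * X) = G
  generalize hw : -t • (Zᵀ *ᵥ e) + G *ᵥ δ.ofLp = w
  simp only [Matrix.mulVec_smul, Matrix.smul_mulVec, smul_dotProduct, dotProduct_smul, smul_eq_mul]
  have hq : 1 / (n : ℝ) * (-t⁻¹ * (t ^ 2 * (-t⁻¹ * (w ⬝ᵥ (B *ᵥ w))))) = t ^ 2 * (w ⬝ᵥ (B *ᵥ w)) := by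
    rw [one_div, ← htn]
    field_simp
  -- Multiplying by the conjugate turns the difference of roots into a difference of squares, from
  -- which a factor `t` comes out.
  have hpen : √(ρ * (‖β₀ + t • δ‖ ^ 2 + 1)) - √(ρ * (‖β₀‖ ^ 2 + 1))
      = t * (√ρ * ((2 * (β₀.ofLp ⬝ᵥ δ.ofLp) + t * ‖δ‖ ^ 2)
        / (√(‖β₀ + t • δ‖ ^ 2 + 1) + √(‖β₀‖ ^ 2 + 1)))) := by
    rw [Real.sqrt_mul hρ, Real.sqrt_mul hρ]
    have h1 : 0 < √(‖β₀ + t • δ‖ ^ 2 + 1) + √(‖β₀‖ ^ 2 + 1) := by positivity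
    have h2 : (√(‖β₀ + t • δ‖ ^ 2 + 1)) ^ 2 = ‖β₀ + t • δ‖ ^ 2 + 1 :=
      Real.sq_sqrt (by positivity)
    have h3 : (√(‖β₀‖ ^ 2 + 1)) ^ 2 = ‖β₀‖ ^ 2 + 1 := Real.sq_sqrt (by positivity)
    have h4 : ‖β₀ + t • δ‖ ^ 2 = ‖β₀‖ ^ 2 + 2 * (t * (β₀.ofLp ⬝ᵥ δ.ofLp)) + t ^ 2 * ‖δ‖ ^ 2 := by
      rw [norm_add_sq_real, inner_smul_right, norm_smul, mul_pow, Real.norm_eq_abs, sq_abs,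
        EuclideanSpace.inner_eq_star_dotProduct, star_trivial, dotProduct_comm]
    rw [← mul_sub, mul_left_comm t]
    congr 1
    rw [mul_div_assoc', eq_div_iff h1.ne']
    linear_combination h2 - h3 + h4
  rw [mul_add t, ← hpen, hq, Real.sqrt_mul (by positivity), Real.sqrt_sq ht0.le]
  ring

/-- Both terms are multiples of norms of affine functions of `β`: the projected residual, and the
pair `(β, 1)` in the `ℓ²` product. -/
theorem convexOn_driveObjective (X : Matrix (Fin n) (Fin p) ℝ) (Y : Fin n → ℝ)
    (Z : Matrix (Fin n) (Fin d) ℝ) {ρ : ℝ} (hρ : 0 ≤ ρ) :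
    ConvexOn ℝ Set.univ (driveObjective X Y Z ρ) := by
  have hfirst : ConvexOn ℝ Set.univ fun β : EuclideanSpace ℝ (Fin p) =>
      √((1 / (n : ℝ)) * ∑ i, ((projMatrix Z *ᵥ Y - projMatrix Z *ᵥ (X *ᵥ β.ofLp)) i) ^ 2) := by
    have hc : ConvexOn ℝ Set.univ fun β : EuclideanSpace ℝ (Fin p) =>
        √(1 / (n : ℝ)) * ‖(WithLp.toLp 2 (projMatrix Z *ᵥ Y) : EuclideanSpace ℝ (Fin n))
          - Matrix.toEuclideanLin (projMatrix Z * X) β‖ := by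
      have h0 : ConvexOn ℝ Set.univ fun v : EuclideanSpace ℝ (Fin n) =>
          ‖(WithLp.toLp 2 (projMatrix Z *ᵥ Y) : EuclideanSpace ℝ (Fin n)) - v‖ := by
        simpa [dist_eq_norm, norm_sub_rev] using
          convexOn_univ_dist (WithLp.toLp 2 (projMatrix Z *ᵥ Y) : EuclideanSpace ℝ (Fin n))
      have h1 := (h0.comp_linearMap (Matrix.toEuclideanLin (projMatrix Z * X))).smul
        (Real.sqrt_nonneg (1 / (n : ℝ)))
      simpa using h1
    convert hc using 2 with β
    rw [Real.sqrt_mul (by positivity), EuclideanSpace.norm_eq]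
    congr 3
    ext i
    simp [Matrix.toLpLin_apply, Matrix.mulVec_mulVec]
  have hsecond : ConvexOn ℝ Set.univ fun β : EuclideanSpace ℝ (Fin p) =>
      √(ρ * (‖β‖ ^ 2 + 1)) := by
    have h0 : ConvexOn ℝ Set.univ fun v : WithLp 2 (EuclideanSpace ℝ (Fin p) × ℝ) => ‖v‖ :=
      convexOn_univ_norm
    refine ⟨convex_univ, fun x _ y _ a b ha hb hab => ?_⟩
    have h1 := h0.2 (Set.mem_univ (WithLp.toLp 2 (x, (1 : ℝ))))
      (Set.mem_univ (WithLp.toLp 2 (y, (1 : ℝ)))) ha hb hab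
    have h2 : a • WithLp.toLp 2 (x, (1 : ℝ)) + b • WithLp.toLp 2 (y, (1 : ℝ))
        = WithLp.toLp 2 (a • x + b • y, (1 : ℝ)) := by
      rw [← WithLp.toLp_smul, ← WithLp.toLp_smul, ← WithLp.toLp_add]
      simp [hab]
    rw [h2] at h1
    have h3 : ∀ u : EuclideanSpace ℝ (Fin p), ‖WithLp.toLp 2 (u, (1 : ℝ))‖ = √(‖u‖ ^ 2 + 1) :=
      fun u => by simp [WithLp.prod_norm_eq_of_L2]
    simp only [h3, smul_eq_mul] at h1
    simp only [Real.sqrt_mul hρ, smul_eq_mul]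
    nlinarith [mul_le_mul_of_nonneg_left h1 (Real.sqrt_nonneg ρ)]
  exact hfirst.add hsecond

/-- A minimizer of a convex function lies within `η` of any point whose value is strictly below all
values on the sphere of radius `η` around it. -/
theorem ConvexOn.norm_sub_le_of_lt_sphere {E : Type*} [NormedAddCommGroup E] [NormedSpace ℝ E]
    {f : E → ℝ} (hf : ConvexOn ℝ Set.univ f) {x₀ x : E} {η : ℝ} (hη : 0 < η)
    (hlt : ∀ y, ‖y - x₀‖ = η → f x₀ < f y) (hx : f x ≤ f x₀) : ‖x - x₀‖ ≤ η := by
  by_contra! h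
  have hpos : 0 < ‖x - x₀‖ := hη.trans h
  set s := η / ‖x - x₀‖ with hs
  have hs0 : 0 < s := by positivity
  have hs1 : s < 1 := (div_lt_one hpos).2 h
  have h1 := hlt ((1 - s) • x₀ + s • x) (by
    have : (1 - s) • x₀ + s • x - x₀ = s • (x - x₀) := by
      rw [sub_smul, one_smul, smul_sub]; abel
    rw [this, norm_smul, Real.norm_eq_abs, abs_of_pos hs0, hs, div_mul_cancel₀ _ hpos.ne'])
  have h2 := hf.2 (Set.mem_univ x₀) (Set.mem_univ x) (sub_pos.2 hs1).le hs0.le (by ring)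
  simp only [smul_eq_mul] at h2
  nlinarith

/-- The normal equations make the projected residual orthogonal to the range of `Π_Z X`, and
Pythagoras gives minimality. This makes the TSLS limit an instance of the DRIVE limit. -/
theorem isDriveEstimate_tslsEstimate {X : Matrix (Fin n) (Fin p) ℝ} (Y : Fin n → ℝ)
    {Z : Matrix (Fin n) (Fin d) ℝ} (hZ : IsUnit (Zᵀ * Z).det)
    (hX : IsUnit (Xᵀ * projMatrix Z * X).det) :
    IsDriveEstimate X Y Z 0 (tslsEstimate X Y Z) := by
  intro b
  rw [driveObjective_eq, driveObjective_eq]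
  set bh := tslsEstimate X Y Z with hbh
  have hnormal : Xᵀ *ᵥ (projMatrix Z *ᵥ (Y - X *ᵥ bh.ofLp)) = 0 := by
    simp only [hbh, tslsEstimate, Matrix.mulVec_sub, Matrix.mulVec_mulVec]
    rw [← Matrix.mul_assoc, ← Matrix.mul_assoc, ← Matrix.mul_assoc, ← Matrix.mul_assoc,
      Matrix.mul_nonsing_inv _ hX, Matrix.one_mul, sub_self]
  have hsplit : projMatrix Z *ᵥ (Y - X *ᵥ b.ofLp)
      = projMatrix Z *ᵥ (Y - X *ᵥ bh.ofLp) + projMatrix Z *ᵥ (X *ᵥ (bh.ofLp - b.ofLp)) := by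
    rw [← Matrix.mulVec_add, Matrix.mulVec_sub X]
    congr 1
    abel
  have hcross : (projMatrix Z *ᵥ (Y - X *ᵥ bh.ofLp)) ⬝ᵥ
      (projMatrix Z *ᵥ (X *ᵥ (bh.ofLp - b.ofLp))) = 0 := by
    rw [Matrix.dotProduct_mulVec, ← Matrix.mulVec_transpose, projMatrix_transpose,
      Matrix.mulVec_mulVec, projMatrix_mul_self hZ, Matrix.dotProduct_mulVec,
      ← Matrix.mulVec_transpose, hnormal, zero_dotProduct]
  have hle : (projMatrix Z *ᵥ (Y - X *ᵥ bh.ofLp)) ⬝ᵥ (projMatrix Z *ᵥ (Y - X *ᵥ bh.ofLp))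
      ≤ (projMatrix Z *ᵥ (Y - X *ᵥ b.ofLp)) ⬝ᵥ (projMatrix Z *ᵥ (Y - X *ᵥ b.ofLp)) := by
    rw [hsplit, add_dotProduct, dotProduct_add, dotProduct_add, hcross,
      dotProduct_comm (projMatrix Z *ᵥ (X *ᵥ (bh.ofLp - b.ofLp)))
        (projMatrix Z *ᵥ (Y - X *ᵥ bh.ofLp)), hcross]
    have : 0 ≤ (projMatrix Z *ᵥ (X *ᵥ (bh.ofLp - b.ofLp))) ⬝ᵥ
        (projMatrix Z *ᵥ (X *ᵥ (bh.ofLp - b.ofLp))) :=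
      Finset.sum_nonneg fun i _ => mul_self_nonneg _
    linarith
  rw [zero_mul, zero_mul]
  gcongr

end localObjective

/-! ### Stability of the minimizer under perturbation of the objective. -/

section argmin

variable {n p d : ℕ}

/-- The strict inequality is an open condition on parameter, score and displacement jointly. Writing
`δ = m z + u` lets `(z, u)` range over one fixed compact set, a ball times a sphere, so a single
neighbourhood of `θ₀` serves all of it. -/
theorem eventually_localObjective_lt {β₀ : EuclideanSpace ℝ (Fin p)}
    {m : EuclideanSpace ℝ (Fin d) → EuclideanSpace ℝ (Fin p)} (hm : Continuous m)
    {θ₀ : Matrix (Fin d) (Fin d) ℝ × Matrix (Fin d) (Fin p) ℝ × ℝ × ℝ}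
    (hlt : ∀ z δ, δ ≠ m z → localObjective β₀ θ₀.1 θ₀.2.1 θ₀.2.2.1 θ₀.2.2.2 z (m z)
      < localObjective β₀ θ₀.1 θ₀.2.1 θ₀.2.2.1 θ₀.2.2.2 z δ) (R : ℝ) {η : ℝ} (hη : 0 < η) :
    ∀ᶠ θ in 𝓝 θ₀, ∀ z, ‖z‖ ≤ R → ∀ δ, ‖δ - m z‖ = η →
      localObjective β₀ θ.1 θ.2.1 θ.2.2.1 θ.2.2.2 z (m z)
        < localObjective β₀ θ.1 θ.2.1 θ.2.2.1 θ.2.2.2 z δ := by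
  have hK : IsCompact (Metric.closedBall (0 : EuclideanSpace ℝ (Fin d)) R ×ˢ
      Metric.sphere (0 : EuclideanSpace ℝ (Fin p)) η) :=
    (isCompact_closedBall _ _).prod (isCompact_sphere _ _)
  have h := hK.eventually_forall_of_forall_eventually (x₀ := θ₀)
    (P := fun θ y => localObjective β₀ θ.1 θ.2.1 θ.2.2.1 θ.2.2.2 y.1 (m y.1)
        < localObjective β₀ θ.1 θ.2.1 θ.2.2.1 θ.2.2.2 y.1 (m y.1 + y.2)) ?_
  · filter_upwards [h] with θ hθ z hz δ hδ
    have := hθ (z, δ - m z) ⟨by simpa using hz, by simpa using hδ⟩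
    simpa using this
  · rintro ⟨z, u⟩ ⟨-, hu⟩
    have hu0 : u ≠ 0 := by
      rintro rfl
      simp at hu
      exact hη.ne hu
    have hF := continuous_localObjective (d := d) β₀
    have h1 : Continuous fun x : (Matrix (Fin d) (Fin d) ℝ × Matrix (Fin d) (Fin p) ℝ × ℝ × ℝ)
        × (EuclideanSpace ℝ (Fin d) × EuclideanSpace ℝ (Fin p)) =>
        localObjective β₀ x.1.1 x.1.2.1 x.1.2.2.1 x.1.2.2.2 x.2.1 (m x.2.1) :=
      hF.comp (g := fun x => _) (f := fun x : (Matrix (Fin d) (Fin d) ℝ ×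
        Matrix (Fin d) (Fin p) ℝ × ℝ × ℝ) × (EuclideanSpace ℝ (Fin d) × EuclideanSpace ℝ (Fin p)) =>
        (x.1, (x.2.1, m x.2.1))) (by fun_prop)
    have h2 : Continuous fun x : (Matrix (Fin d) (Fin d) ℝ × Matrix (Fin d) (Fin p) ℝ × ℝ × ℝ)
        × (EuclideanSpace ℝ (Fin d) × EuclideanSpace ℝ (Fin p)) =>
        localObjective β₀ x.1.1 x.1.2.1 x.1.2.2.1 x.1.2.2.2 x.2.1 (m x.2.1 + x.2.2) :=
      hF.comp (g := fun x => _) (f := fun x : (Matrix (Fin d) (Fin d) ℝ ×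
        Matrix (Fin d) (Fin p) ℝ × ℝ × ℝ) × (EuclideanSpace ℝ (Fin d) × EuclideanSpace ℝ (Fin p)) =>
        (x.1, (x.2.1, m x.2.1 + x.2.2))) (by fun_prop)
    exact h1.continuousAt.eventually_lt h2.continuousAt (hlt z _ (by simpa using hu0))

/-- The deterministic core: comparing values on one sphere locates the global minimizer, by
convexity. A radius `η` in `δ` is a radius `η/√n` in `β`. -/
theorem IsDriveEstimate.norm_sub_le (hn : 0 < n) {X : Matrix (Fin n) (Fin p) ℝ} {Y e : Fin n → ℝ}
    {Z : Matrix (Fin n) (Fin d) ℝ} (hZ : IsUnit (Zᵀ * Z).det) {ρ : ℝ} (hρ : 0 ≤ ρ)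
    {β₀ β m : EuclideanSpace ℝ (Fin p)} (hY : Y = X *ᵥ β₀.ofLp + e)
    (hβ : IsDriveEstimate X Y Z ρ β) {η : ℝ} (hη : 0 < η)
    (hlt : ∀ δ, ‖δ - m‖ = η →
      localObjective β₀ ((n : ℝ)⁻¹ • (Zᵀ * Z))⁻¹ ((n : ℝ)⁻¹ • (Zᵀ * X)) ρ
          (√(n : ℝ))⁻¹ (WithLp.toLp 2 (-(√(n : ℝ))⁻¹ • (Zᵀ *ᵥ e))) m
      < localObjective β₀ ((n : ℝ)⁻¹ • (Zᵀ * Z))⁻¹ ((n : ℝ)⁻¹ • (Zᵀ * X)) ρ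
          (√(n : ℝ))⁻¹ (WithLp.toLp 2 (-(√(n : ℝ))⁻¹ • (Zᵀ *ᵥ e))) δ) :
    ‖√(n : ℝ) • (β - β₀) - m‖ ≤ η := by
  have hs : 0 < √(n : ℝ) := Real.sqrt_pos.2 (by exact_mod_cast hn)
  have hscale : ∀ y : EuclideanSpace ℝ (Fin p),
      ‖√(n : ℝ) • (y - β₀) - m‖ = √(n : ℝ) * ‖y - (β₀ + (√(n : ℝ))⁻¹ • m)‖ := by
    intro y
    have : √(n : ℝ) • (y - β₀) - m = √(n : ℝ) • (y - (β₀ + (√(n : ℝ))⁻¹ • m)) := by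
      rw [← sub_sub, smul_sub (√(n : ℝ)) (y - β₀), smul_smul, mul_inv_cancel₀ hs.ne', one_smul]
    rw [this, norm_smul, Real.norm_eq_abs, abs_of_pos hs]
  have key := (convexOn_driveObjective X Y Z hρ).norm_sub_le_of_lt_sphere
    (x₀ := β₀ + (√(n : ℝ))⁻¹ • m) (x := β) (η := (√(n : ℝ))⁻¹ * η) (by positivity) ?_ (hβ _)
  · rw [hscale]
    calc √(n : ℝ) * ‖β - (β₀ + (√(n : ℝ))⁻¹ • m)‖ ≤ √(n : ℝ) * ((√(n : ℝ))⁻¹ * η) := by gcongr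
      _ = η := by field_simp
  · intro y hy
    have hy' : ‖√(n : ℝ) • (y - β₀) - m‖ = η := by
      rw [hscale, hy]; field_simp
    have hyeq : y = β₀ + (√(n : ℝ))⁻¹ • (√(n : ℝ) • (y - β₀)) := by
      rw [smul_smul, inv_mul_cancel₀ hs.ne', one_smul]; abel
    rw [hyeq, driveObjective_add_smul hn hZ hρ hY, driveObjective_add_smul hn hZ hρ hY]
    have := hlt _ hy'
    gcongr

end argmin

/-! ### Convergence in probability from tightness, Gaussian images, and the multivariate CLT. -/

section probability

/-- If `D n → 0` almost surely on the events where `W n` stays bounded, and `W` converges in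
distribution, then `D → 0` in probability. -/
theorem tendstoInMeasure_zero_of_bounded {Ω Ω' E F : Type*} [MeasurableSpace Ω]
    [MeasurableSpace Ω'] {P : Measure Ω} [IsProbabilityMeasure P] {Q : Measure Ω'}
    [IsProbabilityMeasure Q] [NormedAddCommGroup E] [MeasurableSpace E] [BorelSpace E]
    [SecondCountableTopology E] [CompleteSpace E] [NormedAddCommGroup F]
    {W : ℕ → Ω → E} {V : Ω' → E}
    (hW : TendstoInDistribution W atTop V (fun _ => P) Q) {D : ℕ → Ω → F}
    (hD : ∀ n, AEStronglyMeasurable (D n) P)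
    (hlim : ∀ᵐ ω ∂P, ∀ R η : ℝ, 0 < η → ∀ᶠ n in atTop, ‖W n ω‖ ≤ R → ‖D n ω‖ ≤ η) :
    TendstoInMeasure P D atTop 0 := by
  rw [tendstoInMeasure_iff_norm]
  intro η hη
  rw [ENNReal.tendsto_nhds_zero]
  intro ε hε
  have hε2 : ε / 2 ≠ 0 := (ENNReal.half_pos hε.ne').ne'
  have hprob : IsProbabilityMeasure (Q.map V) :=
    Measure.isProbabilityMeasure_map hW.aemeasurable_limit
  obtain ⟨δ, hδ0, hδ⟩ := ENNReal.lt_iff_exists_nnreal_btwn.1 (pos_iff_ne_zero.2 hε2)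
  obtain ⟨K, hK, hKQ⟩ := isTightMeasureSet_iff_exists_isCompact_measure_compl_le.1
    (isTightMeasureSet_singleton (μ := Q.map V)) δ hδ0
  obtain ⟨R, hR⟩ := hK.isBounded.subset_closedBall (0 : E)
  -- The portmanteau bound needs a closed set. The margin 1 keeps this one disjoint from the ball of
  -- radius `R` containing `K`.
  have hF : IsClosed {x : E | R + 1 ≤ ‖x‖} := isClosed_le continuous_const continuous_norm
  have hFQ : (Q.map V) {x : E | R + 1 ≤ ‖x‖} < ε / 2 := by
    refine lt_of_le_of_lt ((measure_mono ?_).trans (hKQ _ rfl)) hδ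
    intro x hx hxK
    have h1 := hR hxK
    rw [mem_closedBall_zero_iff] at h1
    have h2 : R + 1 ≤ ‖x‖ := hx
    linarith
  have hport := ProbabilityMeasure.limsup_measure_closed_le_of_tendsto hW.tendsto hF
  have hev := eventually_lt_of_limsup_lt (lt_of_le_of_lt hport hFQ)
  have hset : ∀ n, NullMeasurableSet {ω | ‖W n ω‖ ≤ R + 1} P := fun n =>
    nullMeasurableSet_le (hW.forall_aemeasurable n).norm aemeasurable_const
  -- Cut off where `W n` is large, `D n` tends to 0 almost surely, hence in measure.
  have htrunc : TendstoInMeasure P (fun n => {ω | ‖W n ω‖ ≤ R + 1}.indicator (D n)) atTop 0 := by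
    refine tendstoInMeasure_of_tendsto_ae (fun n => (hD n).indicator₀ (hset n)) ?_
    filter_upwards [hlim] with ω hω
    rw [Pi.zero_apply, NormedAddGroup.tendsto_nhds_zero]
    intro η' hη'
    filter_upwards [hω (R + 1) (η' / 2) (by positivity)] with n hn
    by_cases h : ‖W n ω‖ ≤ R + 1
    · have : ω ∈ {ω | ‖W n ω‖ ≤ R + 1} := h
      rw [Set.indicator_of_mem this]
      linarith [hn h]
    · have : ω ∉ {ω | ‖W n ω‖ ≤ R + 1} := h
      rw [Set.indicator_of_notMem this, norm_zero]
      exact hη'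
  rw [tendstoInMeasure_iff_norm] at htrunc
  have htrunc' := ENNReal.tendsto_nhds_zero.1 (htrunc η hη) (ε / 2) (ENNReal.half_pos hε.ne')
  filter_upwards [hev, htrunc'] with n h1 h2
  have h3 : P {ω | R + 1 ≤ ‖W n ω‖} ≤ ε / 2 := by
    have := Measure.map_apply_of_aemeasurable (hW.forall_aemeasurable n) hF.measurableSet
    refine le_of_eq_of_le ?_ h1.le
    exact this.symm
  calc P {ω | η ≤ ‖D n ω - (0 : Ω → F) ω‖}
      ≤ P ({ω | η ≤ ‖{ω | ‖W n ω‖ ≤ R + 1}.indicator (D n) ω - (0 : Ω → F) ω‖}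
          ∪ {ω | R + 1 ≤ ‖W n ω‖}) := by
        apply measure_mono
        intro ω hω
        by_cases h : ‖W n ω‖ ≤ R + 1
        · left
          have : ω ∈ {ω | ‖W n ω‖ ≤ R + 1} := h
          simpa only [Set.mem_ofPred_eq, Set.indicator_of_mem this] using hω
        · right
          exact (not_le.1 h).le
    _ ≤ ε / 2 + ε / 2 := (measure_union_le _ _).trans (add_le_add h2 h3)
    _ = ε := ENNReal.add_halves ε

/-- A linear image of a centred Gaussian vector is Gaussian. -/
theorem multivariateGaussian_map_mulVec {p d : ℕ} {S : Matrix (Fin d) (Fin d) ℝ}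
    (hS : S.PosSemidef) (M : Matrix (Fin p) (Fin d) ℝ) :
    (multivariateGaussian 0 S).map (fun z => WithLp.toLp 2 (M *ᵥ z.ofLp))
      = multivariateGaussian 0 (M * S * Mᵀ) := by
  have hMS : (M * S * Mᵀ).PosSemidef := by
    have := hS.mul_mul_conjTranspose_same M
    rwa [Matrix.conjTranspose_eq_transpose_of_trivial] at this
  have hmeas : Measurable fun z : EuclideanSpace ℝ (Fin d) =>
      (WithLp.toLp 2 (M *ᵥ z.ofLp) : EuclideanSpace ℝ (Fin p)) :=
    ((PiLp.continuous_toLp 2 _).comp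
      (continuous_const.matrix_mulVec (PiLp.continuous_ofLp 2 _))).measurable
  have hprob := Measure.isProbabilityMeasure_map (μ := multivariateGaussian 0 S) hmeas.aemeasurable
  apply Measure.ext_of_charFun
  ext t
  have hinner : ∀ z : EuclideanSpace ℝ (Fin d),
      inner ℝ (WithLp.toLp 2 (M *ᵥ z.ofLp) : EuclideanSpace ℝ (Fin p)) t
        = inner ℝ z (WithLp.toLp 2 (Mᵀ *ᵥ t.ofLp)) := by
    intro z
    simp only [EuclideanSpace.inner_eq_star_dotProduct, star_trivial]
    rw [Matrix.dotProduct_mulVec, Matrix.mulVec_transpose]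
  rw [charFun_apply, integral_map hmeas.aemeasurable (by fun_prop)]
  simp_rw [hinner]
  rw [← charFun_apply, charFun_multivariateGaussian hS, charFun_multivariateGaussian hMS]
  simp only [inner_zero_right]
  congr 4
  rw [← Matrix.mulVec_mulVec, ← Matrix.mulVec_mulVec, Matrix.mulVec_transpose,
    Matrix.dotProduct_mulVec t.ofLp M]

/-- The multivariate central limit theorem for centred vectors. -/
theorem tendstoInDistribution_multivariate {Ω : Type*} [MeasurableSpace Ω] {P : Measure Ω}
    [IsProbabilityMeasure P] {d : ℕ} {V : ℕ → Ω → EuclideanSpace ℝ (Fin d)}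
    (hindep : iIndepFun V P) (hident : ∀ i, IdentDistrib (V i) (V 0) P P)
    (hL2 : MemLp (V 0) 2 P) (hmean : ∀ j, ∫ ω, V 0 ω j ∂P = 0) :
    TendstoInDistribution (fun (n : ℕ) ω => (√(n : ℝ))⁻¹ • ∑ k ∈ Finset.range n, V k ω) atTop
      (id : EuclideanSpace ℝ (Fin d) → EuclideanSpace ℝ (Fin d)) (fun _ => P)
      (multivariateGaussian 0 (momentMatrix P (V 0) (V 0))) := by
  have hcoord : ∀ j, MemLp (fun ω => V 0 ω j) 2 P := fun j => hL2.eval_piLp j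
  have hint : ∀ i j, Integrable (fun ω => V 0 ω i * V 0 ω j) P := fun i j =>
    (hcoord i).integrable_mul (hcoord j)
  have hinner : ∀ (t : EuclideanSpace ℝ (Fin d)) (k : ℕ) (ω : Ω),
      inner ℝ (V k ω) t = ∑ j, t j * V k ω j := by
    intro t k ω
    simp [PiLp.inner_apply]
  have hsecond : ∀ t : EuclideanSpace ℝ (Fin d),
      ∫ ω, (inner ℝ (V 0 ω) t) ^ 2 ∂P = t.ofLp ⬝ᵥ (momentMatrix P (V 0) (V 0) *ᵥ t.ofLp) := by
    intro t
    have h1 : ∀ ω, (inner ℝ (V 0 ω) t) ^ 2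
        = ∑ i, ∑ j, t i * t j * (V 0 ω i * V 0 ω j) := by
      intro ω
      rw [hinner, sq, Finset.sum_mul_sum]
      exact Finset.sum_congr rfl fun i _ => Finset.sum_congr rfl fun j _ => by ring
    simp_rw [h1]
    rw [integral_finsetSum _ fun i _ => integrable_finsetSum _ fun j _ => (hint i j).const_mul _]
    simp only [dotProduct, Matrix.mulVec, momentMatrix, Matrix.of_apply, Finset.mul_sum]
    refine Finset.sum_congr rfl fun i _ => ?_
    rw [integral_finsetSum _ fun j _ => (hint i j).const_mul _]
    refine Finset.sum_congr rfl fun j _ => ?_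
    rw [integral_const_mul]
    ring
  have hpsd : (momentMatrix P (V 0) (V 0)).PosSemidef := by
    refine Matrix.PosSemidef.of_dotProduct_mulVec_nonneg ?_ fun x => ?_
    · rw [Matrix.IsHermitian, Matrix.conjTranspose_eq_transpose_of_trivial]
      ext i j
      simp [momentMatrix, mul_comm]
    · have := hsecond (WithLp.toLp 2 x)
      simp only [star_trivial] at this ⊢
      rw [← this]
      positivity
  have hVm : ∀ k, AEMeasurable (V k) P := fun k => (hident k).aemeasurable_fst
  have hsum : ∀ n : ℕ, AEMeasurable
      (fun ω => (√(n : ℝ))⁻¹ • ∑ k ∈ Finset.range n, V k ω) P := fun n => by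
    have : AEMeasurable (fun ω => ∑ k ∈ Finset.range n, V k ω) P :=
      Finset.aemeasurable_fun_sum _ fun k _ => hVm k
    fun_prop
  refine ⟨hsum, by fun_prop, ?_⟩
  -- Cramér–Wold: the characteristic function of a vector at `t` is that of its projection on `t` at
  -- 1, so the scalar CLT suffices.
  refine ProbabilityMeasure.tendsto_iff_tendsto_charFun.2 fun t => ?_
  have hU : iIndepFun (fun k ω => inner ℝ (V k ω) t) P :=
    hindep.comp (fun _ v => inner ℝ v t) (fun _ => by fun_prop)
  have hUid : ∀ k, IdentDistrib (fun ω => inner ℝ (V k ω) t) (fun ω => inner ℝ (V 0 ω) t) P P :=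
    fun k => (hident k).comp (u := fun v => inner ℝ v t) (by fun_prop)
  have hUL2 : MemLp (fun ω => inner ℝ (V 0 ω) t) 2 P := by
    simp_rw [hinner]
    exact memLp_finsetSum _ fun j _ => (hcoord j).const_mul _
  have hUmean : ∫ ω, inner ℝ (V 0 ω) t ∂P = 0 := by
    simp_rw [hinner]
    rw [integral_finsetSum _ fun j _ =>
      (((hcoord j).integrable (by norm_num)).const_mul _)]
    simp [integral_const_mul, hmean]
  have hvar : Var[fun ω => inner ℝ (V 0 ω) t; P]
      = t.ofLp ⬝ᵥ (momentMatrix P (V 0) (V 0) *ᵥ t.ofLp) := by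
    rw [variance_of_integral_eq_zero hUL2.aemeasurable hUmean, ← hsecond]
  have hclt := tendstoInDistribution_inv_sqrt_mul_sum_sub (X := fun k ω => inner ℝ (V k ω) t)
    (Y := id) (P' := gaussianReal 0 Var[fun ω => inner ℝ (V 0 ω) t; P].toNNReal)
    (P := P) ⟨by fun_prop, by simp⟩ hUL2 hU hUid
  have hchar := ProbabilityMeasure.tendsto_iff_tendsto_charFun.1 hclt.tendsto 1
  have hlim : charFun ((multivariateGaussian 0 (momentMatrix P (V 0) (V 0))).map id) t
      = charFun ((gaussianReal 0 Var[fun ω => inner ℝ (V 0 ω) t; P].toNNReal).map id) 1 := by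
    rw [Measure.map_id, Measure.map_id, charFun_multivariateGaussian hpsd, charFun_gaussianReal,
      Real.coe_toNNReal _ (variance_nonneg _ _), hvar]
    simp
  have hpre : ∀ n : ℕ,
      charFun (P.map fun ω => (√(n : ℝ))⁻¹ • ∑ k ∈ Finset.range n, V k ω) t
      = charFun (P.map fun ω => (√(n : ℝ))⁻¹ * (∑ k ∈ Finset.range n, inner ℝ (V k ω) t
          - n * ∫ ω, inner ℝ (V 0 ω) t ∂P)) 1 := by
    intro n
    have hm2 : AEMeasurable (fun ω => (√(n : ℝ))⁻¹ * (∑ k ∈ Finset.range n, inner ℝ (V k ω) t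
          - n * ∫ ω, inner ℝ (V 0 ω) t ∂P)) P := by
      have : AEMeasurable (fun ω => ∑ k ∈ Finset.range n, inner ℝ (V k ω) t) P :=
        Finset.aemeasurable_fun_sum _ fun k _ => (hUid k).aemeasurable_fst
      fun_prop
    rw [charFun_apply, charFun_apply, integral_map (hsum n) (by fun_prop),
      integral_map hm2 (by fun_prop)]
    congr with ω
    rw [hUmean, inner_smul_left, sum_inner]
    simp
  simp only [ProbabilityMeasure.coe_mk] at hchar ⊢
  rw [hlim]
  simpa only [hpre] using hchar

end probability

/-! ### Measurability of the TSLS estimate. -/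

section measurability

variable {Ω : Type*} [MeasurableSpace Ω] {k l m : ℕ}

theorem measurable_matrix_mul_apply {A : Ω → Matrix (Fin k) (Fin l) ℝ}
    {B : Ω → Matrix (Fin l) (Fin m) ℝ} (hA : ∀ i j, Measurable fun ω => A ω i j)
    (hB : ∀ i j, Measurable fun ω => B ω i j) (i : Fin k) (j : Fin m) :
    Measurable fun ω => (A ω * B ω) i j := by
  simp only [Matrix.mul_apply]
  exact Finset.measurable_fun_sum _ fun r _ => (hA i r).mul (hB r j)

theorem measurable_matrix_mulVec_apply {A : Ω → Matrix (Fin k) (Fin l) ℝ}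
    {v : Ω → Fin l → ℝ} (hA : ∀ i j, Measurable fun ω => A ω i j)
    (hv : ∀ i, Measurable fun ω => v ω i) (i : Fin k) :
    Measurable fun ω => (A ω *ᵥ v ω) i := by
  simp only [Matrix.mulVec, dotProduct]
  exact Finset.measurable_fun_sum _ fun r _ => (hA i r).mul (hv r)

/-- The inverse is `det⁻¹ • adjugate`, with `0⁻¹ = 0` at singular matrices, so it is measurable
everywhere though not continuous. -/
theorem measurable_matrix_inv_apply {A : Ω → Matrix (Fin k) (Fin k) ℝ}
    (hA : ∀ i j, Measurable fun ω => A ω i j) (i j : Fin k) :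
    Measurable fun ω => (A ω)⁻¹ i j := by
  have hA' : Measurable fun ω => (fun i j => A ω i j : Fin k → Fin k → ℝ) :=
    measurable_pi_lambda _ fun i => measurable_pi_lambda _ fun j => hA i j
  have hof : Continuous fun M : Fin k → Fin k → ℝ => Matrix.of M := continuous_id
  have hdet : Measurable fun M : Fin k → Fin k → ℝ => (Matrix.of M).det := hof.matrix_det.measurable
  have hadj : Measurable fun M : Fin k → Fin k → ℝ => (Matrix.of M).adjugate i j :=
    (hof.matrix_adjugate.matrix_elem i j).measurable
  simp only [Matrix.inv_def, Matrix.smul_apply, Ring.inverse_eq_inv', smul_eq_mul]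
  exact (hdet.comp hA').inv.mul (hadj.comp hA')

theorem measurable_tslsEstimate {n p d : ℕ} {X : Ω → Matrix (Fin n) (Fin p) ℝ}
    {Y : Ω → Fin n → ℝ} {Z : Ω → Matrix (Fin n) (Fin d) ℝ}
    (hX : ∀ i j, Measurable fun ω => X ω i j) (hY : ∀ i, Measurable fun ω => Y ω i)
    (hZ : ∀ i j, Measurable fun ω => Z ω i j) :
    Measurable fun ω => tslsEstimate (X ω) (Y ω) (Z ω) := by
  have hXt : ∀ i j, Measurable fun ω => (X ω)ᵀ i j := fun i j => hX j i
  have hZt : ∀ i j, Measurable fun ω => (Z ω)ᵀ i j := fun i j => hZ j i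
  have hproj : ∀ i j, Measurable fun ω => projMatrix (Z ω) i j := by
    simp only [projMatrix]
    exact measurable_matrix_mul_apply (measurable_matrix_mul_apply hZ
      (measurable_matrix_inv_apply (measurable_matrix_mul_apply hZt hZ))) hZt
  have hXP := measurable_matrix_mul_apply hXt hproj
  refine (PiLp.continuous_toLp 2 _).measurable.comp (measurable_pi_lambda _ fun i => ?_)
  exact measurable_matrix_mulVec_apply (measurable_matrix_inv_apply
    (measurable_matrix_mul_apply hXP hX)) (measurable_matrix_mulVec_apply hXP hY) i

end measurability

/-! ### Moments, laws of large numbers and the score CLT in the IV model. -/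

section model

variable {Ω : Type*} [MeasurableSpace Ω] {P : Measure Ω} {p d : ℕ}
  {β₀ : EuclideanSpace ℝ (Fin p)} {γ : Matrix (Fin d) (Fin p) ℝ}
  {X : ℕ → Ω → EuclideanSpace ℝ (Fin p)} {Y : ℕ → Ω → ℝ} {Z : ℕ → Ω → EuclideanSpace ℝ (Fin d)}
  {ε : ℕ → Ω → ℝ} {ξ : ℕ → Ω → EuclideanSpace ℝ (Fin p)}

theorem holderTriple_four_four_two : ENNReal.HolderTriple 4 4 2 where
  inv_add_inv_eq_inv := by
    rw [← two_mul, show (4 : ENNReal) = 2 * 2 by norm_num,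
      ENNReal.mul_inv (by norm_num) (by norm_num), ← mul_assoc,
      ENNReal.mul_inv_cancel (by norm_num) (by norm_num), one_mul]

namespace IsLinearIVSample

theorem error_eq (h : IsLinearIVSample P β₀ γ X Y Z ε ξ) (i : ℕ) (ω : Ω) :
    ε i ω = Y i ω - β₀.ofLp ⬝ᵥ (X i ω).ofLp := by
  rw [h.outcome]; ring

theorem memLp_four [IsProbabilityMeasure P] (h : IsLinearIVSample P β₀ γ X Y Z ε ξ) :
    MemLp (Z 0) 4 P ∧ MemLp (ξ 0) 4 P ∧ MemLp (ε 0) 4 P := by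
  obtain ⟨k, hk, h1, h2, h3⟩ := h.moments
  have : (4 : ENNReal) ≤ ENNReal.ofReal (2 * k) := by
    rw [show (4 : ENNReal) = ENNReal.ofReal 4 by norm_num]
    exact ENNReal.ofReal_le_ofReal (by linarith)
  exact ⟨h1.mono_exponent this, h2.mono_exponent this, h3.mono_exponent this⟩

theorem memLp_Z [IsProbabilityMeasure P] (h : IsLinearIVSample P β₀ γ X Y Z ε ξ) (j : Fin d) :
    MemLp (fun ω => Z 0 ω j) 4 P := h.memLp_four.1.eval_piLp j

theorem memLp_ξ [IsProbabilityMeasure P] (h : IsLinearIVSample P β₀ γ X Y Z ε ξ) (j : Fin p) :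
    MemLp (fun ω => ξ 0 ω j) 4 P := h.memLp_four.2.1.eval_piLp j

theorem first_stage_apply (h : IsLinearIVSample P β₀ γ X Y Z ε ξ) (i : ℕ) (ω : Ω) (j : Fin p) :
    X i ω j = ∑ l, γ l j * Z i ω l + ξ i ω j := by
  have := congrFun (h.first_stage i ω) j
  simpa [Matrix.mulVec, dotProduct] using this

theorem memLp_X [IsProbabilityMeasure P] (h : IsLinearIVSample P β₀ γ X Y Z ε ξ) (j : Fin p) :
    MemLp (fun ω => X 0 ω j) 4 P := by
  simp_rw [h.first_stage_apply]
  exact (memLp_finsetSum _ fun l _ => (h.memLp_Z l).const_mul _).add (h.memLp_ξ j)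

theorem integrable_Z_mul [IsProbabilityMeasure P] {f : Ω → ℝ} (h : IsLinearIVSample P β₀ γ X Y Z ε ξ) (hf : MemLp f 4 P)
    (i : Fin d) : Integrable (fun ω => Z 0 ω i * f ω) P :=
  ((h.memLp_Z i).mono_exponent (by norm_num : (2 : ENNReal) ≤ 4)).integrable_mul
    (hf.mono_exponent (by norm_num : (2 : ENNReal) ≤ 4))

theorem momentMatrix_Z_X [IsProbabilityMeasure P] (h : IsLinearIVSample P β₀ γ X Y Z ε ξ) :
    momentMatrix P (Z 0) (X 0) = momentMatrix P (Z 0) (Z 0) * γ := by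
  ext i j
  have hξ : ∫ ω, Z 0 ω i * ξ 0 ω j ∂P = 0 := by
    have := congrFun (congrFun h.exogenous_ξ i) j
    simpa [momentMatrix] using this
  simp only [momentMatrix, Matrix.of_apply, Matrix.mul_apply]
  simp_rw [h.first_stage_apply, mul_add, Finset.mul_sum]
  have hint : ∀ l, Integrable (fun ω => Z 0 ω i * (γ l j * Z 0 ω l)) P := fun l =>
    h.integrable_Z_mul ((h.memLp_Z l).const_mul _) i
  rw [integral_add (integrable_finsetSum _ fun l _ => hint l) (h.integrable_Z_mul (h.memLp_ξ j) i),
    hξ, add_zero, integral_finsetSum _ fun l _ => hint l]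
  refine Finset.sum_congr rfl fun l _ => ?_
  rw [← integral_mul_const]
  congr with ω
  ring

/-- Exogeneity of `ξ` gives `E[ZXᵀ] = Σγ`. Its rank `p` forces `γ` to be injective, and congruence
by an injective matrix preserves positive definiteness. -/
theorem posDef_firstStage [IsProbabilityMeasure P] (h : IsLinearIVSample P β₀ γ X Y Z ε ξ) :
    (γᵀ * momentMatrix P (Z 0) (Z 0) * γ).PosDef := by
  have hrank : γ.rank = p := by
    have h1 := h.relevance
    rw [h.momentMatrix_Z_X] at h1
    refine le_antisymm (by simpa using γ.rank_le_width) ?_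
    exact h1.symm.le.trans (Matrix.rank_mul_le_right _ _)
  have hinj : Function.Injective γ.mulVec := by
    have h1 := LinearMap.finrank_range_add_finrank_ker γ.mulVecLin
    rw [← Matrix.rank, hrank, Module.finrank_fin_fun] at h1
    have h2 : LinearMap.ker γ.mulVecLin = ⊥ := Submodule.finrank_eq_zero.1 (by omega)
    exact LinearMap.ker_eq_bot.1 h2
  have := h.not_collinear.conjTranspose_mul_mul_same hinj
  rwa [Matrix.conjTranspose_eq_transpose_of_trivial] at this

/-- The law of large numbers for a function of the observations. -/
theorem strong_law (h : IsLinearIVSample P β₀ γ X Y Z ε ξ)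
    {f : EuclideanSpace ℝ (Fin p) × ℝ × EuclideanSpace ℝ (Fin d) → ℝ} (hf : Measurable f)
    (hint : Integrable (fun ω => f (X 0 ω, Y 0 ω, Z 0 ω)) P) :
    ∀ᵐ ω ∂P, Tendsto (fun n : ℕ => (n : ℝ)⁻¹ * ∑ i ∈ Finset.range n, f (X i ω, Y i ω, Z i ω))
      atTop (𝓝 (∫ ω, f (X 0 ω, Y 0 ω, Z 0 ω) ∂P)) :=
  strong_law_ae (fun i ω => f (X i ω, Y i ω, Z i ω)) hint
    (fun _ _ hij => (h.indep.comp (fun _ => f) fun _ => hf).indepFun hij)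
    fun i => (h.ident i).comp hf

theorem tendsto_ZZ [IsProbabilityMeasure P] (h : IsLinearIVSample P β₀ γ X Y Z ε ξ) :
    ∀ᵐ ω ∂P, Tendsto (fun n : ℕ => (n : ℝ)⁻¹ • ((dataMatrix Z n ω)ᵀ * dataMatrix Z n ω)) atTop
      (𝓝 (momentMatrix P (Z 0) (Z 0))) := by
  have hall : ∀ᵐ ω ∂P, ∀ i j, Tendsto (fun n : ℕ => (n : ℝ)⁻¹ *
      ∑ k ∈ Finset.range n, Z k ω i * Z k ω j) atTop (𝓝 (∫ ω, Z 0 ω i * Z 0 ω j ∂P)) := by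
    rw [ae_all_iff]; intro i
    rw [ae_all_iff]; intro j
    exact h.strong_law (f := fun x => x.2.2 i * x.2.2 j) (by fun_prop)
      (h.integrable_Z_mul (h.memLp_Z j) i)
  filter_upwards [hall] with ω hω
  refine tendsto_pi_nhds.2 fun i => tendsto_pi_nhds.2 fun j => ?_
  convert hω i j using 2 with n
  · simp [Matrix.mul_apply, dataMatrix, Finset.sum_range]
  · rfl

theorem tendsto_ZX [IsProbabilityMeasure P] (h : IsLinearIVSample P β₀ γ X Y Z ε ξ) :
    ∀ᵐ ω ∂P, Tendsto (fun n : ℕ => (n : ℝ)⁻¹ • ((dataMatrix Z n ω)ᵀ * dataMatrix X n ω)) atTop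
      (𝓝 (momentMatrix P (Z 0) (Z 0) * γ)) := by
  rw [← h.momentMatrix_Z_X]
  have hall : ∀ᵐ ω ∂P, ∀ i j, Tendsto (fun n : ℕ => (n : ℝ)⁻¹ *
      ∑ k ∈ Finset.range n, Z k ω i * X k ω j) atTop (𝓝 (∫ ω, Z 0 ω i * X 0 ω j ∂P)) := by
    rw [ae_all_iff]; intro i
    rw [ae_all_iff]; intro j
    exact h.strong_law (f := fun x => x.2.2 i * x.1 j) (by fun_prop)
      (h.integrable_Z_mul (h.memLp_X j) i)
  filter_upwards [hall] with ω hω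
  refine tendsto_pi_nhds.2 fun i => tendsto_pi_nhds.2 fun j => ?_
  convert hω i j using 2 with n
  · simp [Matrix.mul_apply, dataMatrix, Finset.sum_range]
  · rfl

theorem isUnit_det_secondMoment (h : IsLinearIVSample P β₀ γ X Y Z ε ξ) :
    IsUnit (momentMatrix P (Z 0) (Z 0)).det :=
  (Matrix.isUnit_iff_isUnit_det _).1 h.not_collinear.isUnit

theorem eventually_isUnit_det [IsProbabilityMeasure P] (h : IsLinearIVSample P β₀ γ X Y Z ε ξ) :
    ∀ᵐ ω ∂P, ∀ᶠ n : ℕ in atTop, IsUnit ((dataMatrix Z n ω)ᵀ * dataMatrix Z n ω).det := by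
  filter_upwards [h.tendsto_ZZ] with ω hω
  have h1 := ((continuous_id.matrix_det).tendsto (momentMatrix P (Z 0) (Z 0))).comp hω
  filter_upwards [h1.eventually_ne h.isUnit_det_secondMoment.ne_zero] with n hn
  rw [isUnit_iff_ne_zero]
  simp only [Function.comp_apply, id, Matrix.det_smul] at hn
  exact right_ne_zero_of_mul hn

theorem tendsto_inv_ZZ [IsProbabilityMeasure P] (h : IsLinearIVSample P β₀ γ X Y Z ε ξ) :
    ∀ᵐ ω ∂P, Tendsto (fun n : ℕ => ((n : ℝ)⁻¹ • ((dataMatrix Z n ω)ᵀ * dataMatrix Z n ω))⁻¹) atTop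
      (𝓝 (momentMatrix P (Z 0) (Z 0))⁻¹) := by
  filter_upwards [h.tendsto_ZZ] with ω hω
  refine Tendsto.comp (continuousAt_matrix_inv _ ?_) hω
  simpa [Ring.inverse_eq_inv'] using
    continuousAt_inv₀ h.isUnit_det_secondMoment.ne_zero

/-- Conditioning on `Z 0` pulls out the instruments and replaces `ε²` by its constant conditional
mean. Fourth moments make the product integrable. -/
theorem integral_mul_error_sq [IsProbabilityMeasure P] (h : IsLinearIVSample P β₀ γ X Y Z ε ξ) (i j : Fin d) :
    ∫ ω, (Z 0 ω i * Z 0 ω j) * ε 0 ω ^ 2 ∂P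
      = (∫ ω, ε 0 ω ^ 2 ∂P) * ∫ ω, Z 0 ω i * Z 0 ω j ∂P := by
  have hm : MeasurableSpace.comap (Z 0) inferInstance ≤ (inferInstance : MeasurableSpace Ω) :=
    (h.measurable_Z 0).comap_le
  have := holderTriple_four_four_two
  have hZZ : MemLp (fun ω => Z 0 ω i * Z 0 ω j) 2 P := (h.memLp_Z j).mul (h.memLp_Z i)
  have hεε : MemLp (fun ω => ε 0 ω ^ 2) 2 P := by
    have := h.memLp_four.2.2.mul (r := 2) h.memLp_four.2.2
    simpa only [sq, Pi.mul_def] using this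
  have hint : Integrable ((fun ω => Z 0 ω i * Z 0 ω j) * fun ω => ε 0 ω ^ 2) P :=
    hZZ.integrable_mul hεε
  have hsm : StronglyMeasurable[MeasurableSpace.comap (Z 0) inferInstance]
      (fun ω => Z 0 ω i * Z 0 ω j) := by
    have : Measurable[MeasurableSpace.comap (Z 0) inferInstance] (Z 0) := comap_measurable _
    have hg : Measurable fun z : EuclideanSpace ℝ (Fin d) => z i * z j := by fun_prop
    exact (hg.comp this).stronglyMeasurable
  have hpull := condExp_mul_of_stronglyMeasurable_left hsm hint (hεε.integrable (by norm_num))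
  calc ∫ ω, (Z 0 ω i * Z 0 ω j) * ε 0 ω ^ 2 ∂P
      = ∫ ω, (P[(fun ω => Z 0 ω i * Z 0 ω j) * fun ω => ε 0 ω ^ 2
          | MeasurableSpace.comap (Z 0) inferInstance]) ω ∂P := (integral_condExp hm).symm
    _ = ∫ ω, (Z 0 ω i * Z 0 ω j) * ∫ ω, ε 0 ω ^ 2 ∂P ∂P := by
        refine integral_congr_ae ?_
        filter_upwards [hpull, h.homoskedastic] with ω h1 h2
        rw [h1, Pi.mul_apply, h2]
    _ = _ := by rw [integral_mul_const, mul_comm]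

theorem momentMatrix_score [IsProbabilityMeasure P] (h : IsLinearIVSample P β₀ γ X Y Z ε ξ) :
    momentMatrix P (fun ω => -ε 0 ω • Z 0 ω) (fun ω => -ε 0 ω • Z 0 ω)
      = (∫ ω, ε 0 ω ^ 2 ∂P) • momentMatrix P (Z 0) (Z 0) := by
  ext i j
  simp only [momentMatrix, Matrix.of_apply, Matrix.smul_apply, smul_eq_mul]
  rw [← h.integral_mul_error_sq]
  congr with ω
  simp
  ring

/-- The central limit theorem for the instruments times the structural errors. -/
theorem tendstoInDistribution_score [IsProbabilityMeasure P] (h : IsLinearIVSample P β₀ γ X Y Z ε ξ) :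
    TendstoInDistribution (fun (n : ℕ) ω => (WithLp.toLp 2 (-(√(n : ℝ))⁻¹ •
        ((dataMatrix Z n ω)ᵀ *ᵥ fun k : Fin n => ε k ω)) : EuclideanSpace ℝ (Fin d))) atTop
      (id : EuclideanSpace ℝ (Fin d) → EuclideanSpace ℝ (Fin d)) (fun _ => P)
      (multivariateGaussian 0 ((∫ ω, ε 0 ω ^ 2 ∂P) • momentMatrix P (Z 0) (Z 0))) := by
  have hf : Measurable fun x : EuclideanSpace ℝ (Fin p) × ℝ × EuclideanSpace ℝ (Fin d) =>
      -(x.2.1 - β₀.ofLp ⬝ᵥ x.1.ofLp) • x.2.2 := by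
    simp only [dotProduct]
    fun_prop
  -- The i.i.d. assumption concerns `(X, Y, Z)`, so the error must be written as a function of
  -- these.
  have hV : ∀ i ω, -ε i ω • Z i ω = -(Y i ω - β₀.ofLp ⬝ᵥ (X i ω).ofLp) • Z i ω := fun i ω => by
    rw [h.error_eq]
  have hindep : iIndepFun (fun i ω => -ε i ω • Z i ω) P := by
    simp_rw [hV]
    exact h.indep.comp (fun _ => _) fun _ => hf
  have hident : ∀ i, IdentDistrib (fun ω => -ε i ω • Z i ω) (fun ω => -ε 0 ω • Z 0 ω) P P := by
    intro i
    simp_rw [hV]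
    exact (h.ident i).comp hf
  have := holderTriple_four_four_two
  have hL2 : MemLp (fun ω => -ε 0 ω • Z 0 ω) 2 P :=
    h.memLp_four.1.smul h.memLp_four.2.2.neg
  have hmean : ∀ j, ∫ ω, (-ε 0 ω • Z 0 ω) j ∂P = 0 := by
    intro j
    have := h.exogenous_ε j
    simp only [PiLp.smul_apply, smul_eq_mul, neg_mul, integral_neg, neg_eq_zero]
    simpa [mul_comm] using this
  have hclt := tendstoInDistribution_multivariate hindep hident hL2 hmean
  rw [h.momentMatrix_score] at hclt
  convert hclt using 3 with n ω
  ext j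
  simp [Matrix.mulVec, dotProduct, dataMatrix, Finset.sum_range, mul_comm]

end IsLinearIVSample

end model

/-! ### Asymptotic distribution of approximate and exact minimizers. -/

section limit

variable {Ω : Type*} [MeasurableSpace Ω] {P : Measure Ω} {p d : ℕ}
  {β₀ : EuclideanSpace ℝ (Fin p)} {γ : Matrix (Fin d) (Fin p) ℝ}
  {X : ℕ → Ω → EuclideanSpace ℝ (Fin p)} {Y : ℕ → Ω → ℝ} {Z : ℕ → Ω → EuclideanSpace ℝ (Fin d)}
  {ε : ℕ → Ω → ℝ} {ξ : ℕ → Ω → EuclideanSpace ℝ (Fin p)}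

/-- Cauchy–Schwarz and the Rayleigh bound give the factor `‖β₀‖² / (1 + ‖β₀‖²) < 1` in front of
`hᵀAh`, so the inequality is strict even when `ρ` equals the smallest eigenvalue. -/
theorem sq_penalty_lt {A : Matrix (Fin p) (Fin p) ℝ} (hA : A.PosDef) (hp : 0 < p) {ρ : ℝ}
    (hρ : 0 ≤ ρ) (hle : ρ ≤ lambdaLast hp hA.isHermitian) (β₀ : EuclideanSpace ℝ (Fin p))
    {h : Fin p → ℝ} (hh : h ≠ 0) :
    (((√ρ / √(1 + ‖β₀‖ ^ 2)) • β₀.ofLp) ⬝ᵥ h) ^ 2 < h ⬝ᵥ (A *ᵥ h) := by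
  have hq := hA.dotProduct_pos hh
  have hray := hA.isHermitian.lambdaLast_mul_le hp h
  have hcs : (β₀.ofLp ⬝ᵥ h) ^ 2 ≤ ‖β₀‖ ^ 2 * (h ⬝ᵥ h) := by
    have h1 : ‖β₀‖ ^ 2 = ∑ i, β₀.ofLp i ^ 2 := by
      rw [EuclideanSpace.norm_sq_eq]; simp
    rw [h1]
    simp only [dotProduct, ← sq]
    exact Finset.sum_mul_sq_le_sq_mul_sq _ _ _
  have hhh : 0 ≤ h ⬝ᵥ h := Finset.sum_nonneg fun i _ => mul_self_nonneg _
  have hb : 0 < 1 + ‖β₀‖ ^ 2 := by positivity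
  rw [smul_dotProduct, smul_eq_mul, mul_pow, div_pow, Real.sq_sqrt hρ, Real.sq_sqrt hb.le,
    div_mul_eq_mul_div, div_lt_iff₀ hb]
  have h1 : ρ * (β₀.ofLp ⬝ᵥ h) ^ 2 ≤ ‖β₀‖ ^ 2 * (ρ * (h ⬝ᵥ h)) := by
    calc ρ * (β₀.ofLp ⬝ᵥ h) ^ 2 ≤ ρ * (‖β₀‖ ^ 2 * (h ⬝ᵥ h)) := by gcongr
      _ = _ := by ring
  have h2 : ρ * (h ⬝ᵥ h) ≤ h ⬝ᵥ (A *ᵥ h) :=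
    (mul_le_mul_of_nonneg_right hle hhh).trans hray
  nlinarith [mul_le_mul_of_nonneg_left h2 (sq_nonneg ‖β₀‖)]

namespace IsLinearIVSample

theorem outcome_eq (h : IsLinearIVSample P β₀ γ X Y Z ε ξ) (n : ℕ) (ω : Ω) :
    dataVector Y n ω = dataMatrix X n ω *ᵥ β₀.ofLp + fun k : Fin n => ε k ω := by
  ext k
  simp only [dataVector, h.outcome, Pi.add_apply, Matrix.mulVec, dataMatrix]
  rw [dotProduct_comm]
  rfl

variable [IsProbabilityMeasure P]

theorem exists_continuous_argmin (h : IsLinearIVSample P β₀ γ X Y Z ε ξ) (hp : 0 < p) {ρ : ℝ}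
    (hρ : 0 ≤ ρ) (hle : ρ ≤ lambdaLast hp (isHermitian_firstStage P (Z 0) γ)) :
    ∃ m : EuclideanSpace ℝ (Fin d) → EuclideanSpace ℝ (Fin p), Continuous m ∧
      (∀ z δ, δ ≠ m z → limitObjective β₀ γ (momentMatrix P (Z 0) (Z 0)) ρ z (m z)
        < limitObjective β₀ γ (momentMatrix P (Z 0) (Z 0)) ρ z δ) ∧
      (ρ = 0 → ∀ z, m z = WithLp.toLp 2
        (-((γᵀ * momentMatrix P (Z 0) (Z 0) * γ)⁻¹ * γᵀ) *ᵥ z.ofLp)) := by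
  obtain ⟨m, hm, hlt, h0⟩ := exists_continuous_minimizer h.not_collinear h.posDef_firstStage
    (c := (√ρ / √(1 + ‖β₀‖ ^ 2)) • β₀.ofLp)
    fun v hv => sq_penalty_lt h.posDef_firstStage hp hρ hle β₀ hv
  refine ⟨m, hm, fun z δ hδ => ?_, fun hρ0 => h0 (by simp [hρ0])⟩
  simpa only [limitObjective, smul_dotProduct, smul_eq_mul] using hlt z δ hδ

/-- The asymptotic distribution of any sequence which eventually solves the DRIVE problem. -/
theorem tendstoInDistribution_of_isDriveEstimate (h : IsLinearIVSample P β₀ γ X Y Z ε ξ)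
    {ρn : ℕ → ℝ} {ρ : ℝ} (hρn : ∀ n, 0 ≤ ρn n) (hρ : Tendsto ρn atTop (𝓝 ρ))
    {m : EuclideanSpace ℝ (Fin d) → EuclideanSpace ℝ (Fin p)} (hm : Continuous m)
    (hlt : ∀ z δ, δ ≠ m z → limitObjective β₀ γ (momentMatrix P (Z 0) (Z 0)) ρ z (m z)
        < limitObjective β₀ γ (momentMatrix P (Z 0) (Z 0)) ρ z δ)
    {βhat : ℕ → Ω → EuclideanSpace ℝ (Fin p)} (hmeas : ∀ n, AEMeasurable (βhat n) P)
    (hβ : ∀ᵐ ω ∂P, ∀ᶠ n in atTop, IsDriveEstimate (dataMatrix X n ω) (dataVector Y n ω)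
      (dataMatrix Z n ω) (ρn n) (βhat n ω)) :
    TendstoInDistribution (fun (n : ℕ) ω => √(n : ℝ) • (βhat n ω - β₀)) atTop m (fun _ => P)
      (multivariateGaussian 0 ((∫ ω, ε 0 ω ^ 2 ∂P) • momentMatrix P (Z 0) (Z 0))) := by
  have hW := h.tendstoInDistribution_score
  set W : ℕ → Ω → EuclideanSpace ℝ (Fin d) := fun n ω => WithLp.toLp 2 (-(√(n : ℝ))⁻¹ •
        ((dataMatrix Z n ω)ᵀ *ᵥ fun k : Fin n => ε k ω)) with hWdef
  have hmW := hW.continuous_comp hm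
  have hδ : ∀ n : ℕ, AEMeasurable (fun ω => √(n : ℝ) • (βhat n ω - β₀)) P := fun n => by
    have := hmeas n
    fun_prop
  -- Slutsky: `m ∘ W n` has the desired limit by continuous mapping, so only the difference matters.
  refine tendstoInDistribution_of_tendstoInMeasure_sub _ _ hmW ?_ hδ
  refine tendstoInMeasure_zero_of_bounded hW
    (fun n => ((hδ n).sub (hmW.forall_aemeasurable n)).aestronglyMeasurable) ?_
  filter_upwards [hβ, h.eventually_isUnit_det, h.tendsto_inv_ZZ, h.tendsto_ZX]
    with ω h1 h2 h3 h4 R η hη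
  have ht : Tendsto (fun n : ℕ => (√(n : ℝ))⁻¹) atTop (𝓝 0) :=
    tendsto_inv_atTop_zero.comp (Real.tendsto_sqrt_atTop.comp tendsto_natCast_atTop_atTop)
  have hθ := h3.prodMk_nhds (h4.prodMk_nhds (hρ.prodMk_nhds ht))
  have hsphere := hθ.eventually (eventually_localObjective_lt (β₀ := β₀) hm
    (fun z δ hδ => by simpa only [localObjective_zero] using hlt z δ hδ) R hη)
  filter_upwards [h1, h2, hsphere, eventually_gt_atTop 0] with n g1 g2 g3 g4 hR
  exact g1.norm_sub_le g4 g2 (hρn n) (h.outcome_eq n ω) hη fun δ => g3 _ hR δ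

/-- The covariance sandwich collapses: `A⁻¹γᵀ Σ γA⁻¹ = A⁻¹` for `A = γᵀΣγ`. -/
theorem map_argmin_zero (h : IsLinearIVSample P β₀ γ X Y Z ε ξ) :
    (multivariateGaussian 0 ((∫ ω, ε 0 ω ^ 2 ∂P) • momentMatrix P (Z 0) (Z 0))).map
      (fun z => WithLp.toLp 2 (-((γᵀ * momentMatrix P (Z 0) (Z 0) * γ)⁻¹ * γᵀ) *ᵥ z.ofLp))
      = multivariateGaussian 0
        ((∫ ω, ε 0 ω ^ 2 ∂P) • (γᵀ * momentMatrix P (Z 0) (Z 0) * γ)⁻¹) := by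
  rw [multivariateGaussian_map_mulVec
    (h.not_collinear.posSemidef.smul (integral_nonneg fun ω => sq_nonneg (ε 0 ω)))]
  congr 1
  have hA := h.posDef_firstStage
  set A := γᵀ * momentMatrix P (Z 0) (Z 0) * γ with hAdef
  have hdet : IsUnit A.det := (Matrix.isUnit_iff_isUnit_det _).1 hA.isUnit
  rw [Matrix.transpose_neg, Matrix.transpose_mul, Matrix.transpose_transpose,
    Matrix.transpose_nonsing_inv, hA.transpose_eq, Matrix.mul_smul, Matrix.smul_mul,
    Matrix.neg_mul, Matrix.neg_mul, Matrix.mul_neg, neg_neg]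
  congr 1
  calc A⁻¹ * γᵀ * momentMatrix P (Z 0) (Z 0) * (γ * A⁻¹)
      = A⁻¹ * (γᵀ * momentMatrix P (Z 0) (Z 0) * γ) * A⁻¹ := by simp only [Matrix.mul_assoc]
    _ = A⁻¹ := by rw [← hAdef, Matrix.nonsing_inv_mul _ hdet, Matrix.one_mul]

/-- `n⁻¹ XᵀΠ_Z X` is built from the normalized moment matrices, and its limit `γᵀΣγ` is invertible.
It guarantees that the TSLS formula eventually solves the normal equations. -/
theorem eventually_isUnit_det_secondStage (h : IsLinearIVSample P β₀ γ X Y Z ε ξ) :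
    ∀ᵐ ω ∂P, ∀ᶠ n : ℕ in atTop,
      IsUnit ((dataMatrix X n ω)ᵀ * projMatrix (dataMatrix Z n ω) * dataMatrix X n ω).det := by
  have hA := h.posDef_firstStage
  have hdet := (Matrix.isUnit_iff_isUnit_det _).1 hA.isUnit
  have hSt := h.not_collinear.transpose_eq
  filter_upwards [h.tendsto_inv_ZZ, h.tendsto_ZX, h.eventually_isUnit_det] with ω h1 h2 h3
  have hcont : Continuous fun x : Matrix (Fin d) (Fin d) ℝ × Matrix (Fin d) (Fin p) ℝ =>
      (Matrix.transpose x.2 * x.1 * x.2).det :=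
    ((continuous_snd.matrix_transpose.matrix_mul continuous_fst).matrix_mul
      continuous_snd).matrix_det
  have hlim := (hcont.tendsto _).comp (h1.prodMk_nhds h2)
  have hne : ((momentMatrix P (Z 0) (Z 0) * γ)ᵀ * (momentMatrix P (Z 0) (Z 0))⁻¹ *
      (momentMatrix P (Z 0) (Z 0) * γ)).det ≠ 0 := by
    rw [Matrix.transpose_mul, hSt, Matrix.mul_assoc γᵀ, Matrix.mul_nonsing_inv _
      h.isUnit_det_secondMoment, Matrix.mul_one, ← Matrix.mul_assoc]
    exact hdet.ne_zero
  filter_upwards [hlim.eventually_ne hne, h3, eventually_gt_atTop 0] with n hn hZ hn0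
  have hn' : (n : ℝ) ≠ 0 := by exact_mod_cast hn0.ne'
  rw [isUnit_iff_ne_zero]
  have hmat : ((n : ℝ)⁻¹ • ((dataMatrix Z n ω)ᵀ * dataMatrix X n ω))ᵀ
        * ((n : ℝ)⁻¹ • ((dataMatrix Z n ω)ᵀ * dataMatrix Z n ω))⁻¹
        * ((n : ℝ)⁻¹ • ((dataMatrix Z n ω)ᵀ * dataMatrix X n ω))
      = (n : ℝ)⁻¹ • ((dataMatrix X n ω)ᵀ * projMatrix (dataMatrix Z n ω) * dataMatrix X n ω) := by
    rw [Matrix.inv_inv_smul hZ hn']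
    simp only [projMatrix, Matrix.transpose_smul, Matrix.transpose_mul, Matrix.transpose_transpose,
      Matrix.smul_mul, Matrix.mul_smul, smul_smul, Matrix.mul_assoc]
    rw [mul_inv_cancel₀ hn', mul_one]
  simp only [Function.comp_apply, hmat, Matrix.det_smul] at hn
  exact right_ne_zero_of_mul hn

end IsLinearIVSample

end limit

/-! ### Assembly of the main theorem. -/

theorem theorem3 {Ω : Type*} [MeasurableSpace Ω] (P : Measure Ω) [IsProbabilityMeasure P]
    {p d : ℕ} (hp : 0 < p)
    (β₀ : EuclideanSpace ℝ (Fin p)) (γ : Matrix (Fin d) (Fin p) ℝ)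
    (X : ℕ → Ω → EuclideanSpace ℝ (Fin p)) (Y : ℕ → Ω → ℝ)
    (Z : ℕ → Ω → EuclideanSpace ℝ (Fin d))
    (ε : ℕ → Ω → ℝ) (ξ : ℕ → Ω → EuclideanSpace ℝ (Fin p))
    (hmodel : IsLinearIVSample P β₀ γ X Y Z ε ξ)
    (ρn : ℕ → ℝ) (ρ : ℝ) (hρn : ∀ n, 0 ≤ ρn n) (hρ : Tendsto ρn atTop (𝓝 ρ))
    (hle : ρ ≤ lambdaLast hp (isHermitian_firstStage P (Z 0) γ))
    (βhat : ℕ → Ω → EuclideanSpace ℝ (Fin p))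
    (hmeas : ∀ n, AEMeasurable (βhat n) P)
    (hβ : ∀ n, ∀ᵐ ω ∂P, IsUnit ((dataMatrix Z n ω)ᵀ * dataMatrix Z n ω).det →
      IsDriveEstimate (dataMatrix X n ω) (dataVector Y n ω) (dataMatrix Z n ω) (ρn n)
        (βhat n ω)) :
    (∃ m : EuclideanSpace ℝ (Fin d) → EuclideanSpace ℝ (Fin p),
      Measurable m ∧
      (∀ z δ, (∀ δ', limitObjective β₀ γ (momentMatrix P (Z 0) (Z 0)) ρ z δ
          ≤ limitObjective β₀ γ (momentMatrix P (Z 0) (Z 0)) ρ z δ') ↔ δ = m z) ∧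
      TendstoInDistribution (fun (n : ℕ) ω => √(n : ℝ) • (βhat n ω - β₀)) atTop m (fun _ => P)
        (multivariateGaussian 0
          ((∫ ω, ε 0 ω ^ 2 ∂P) • momentMatrix P (Z 0) (Z 0)))) ∧
    (ρ = 0 →
      TendstoInDistribution (fun (n : ℕ) ω => √(n : ℝ) • (βhat n ω - β₀)) atTop
        (id : EuclideanSpace ℝ (Fin p) → EuclideanSpace ℝ (Fin p)) (fun _ => P)
        (multivariateGaussian 0
          ((∫ ω, ε 0 ω ^ 2 ∂P) • (γᵀ * momentMatrix P (Z 0) (Z 0) * γ)⁻¹))) ∧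
    TendstoInDistribution
      (fun (n : ℕ) ω => √(n : ℝ) •
        (tslsEstimate (dataMatrix X n ω) (dataVector Y n ω) (dataMatrix Z n ω) - β₀)) atTop
      (id : EuclideanSpace ℝ (Fin p) → EuclideanSpace ℝ (Fin p)) (fun _ => P)
      (multivariateGaussian 0
        ((∫ ω, ε 0 ω ^ 2 ∂P) • (γᵀ * momentMatrix P (Z 0) (Z 0) * γ)⁻¹)) := by
  have hρ0 : 0 ≤ ρ := ge_of_tendsto' hρ hρn
  obtain ⟨m, hm, hlt, hm0⟩ := hmodel.exists_continuous_argmin hp hρ0 hle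
  have hev : ∀ᵐ ω ∂P, ∀ᶠ n in atTop, IsDriveEstimate (dataMatrix X n ω) (dataVector Y n ω)
      (dataMatrix Z n ω) (ρn n) (βhat n ω) := by
    filter_upwards [ae_all_iff.2 hβ, hmodel.eventually_isUnit_det] with ω h1 h2
    filter_upwards [h2] with n hn using h1 n hn
  have hdrive := hmodel.tendstoInDistribution_of_isDriveEstimate hρn hρ hm hlt hmeas hev
  have hgauss : ∀ {D : ℕ → Ω → EuclideanSpace ℝ (Fin p)}
      {m' : EuclideanSpace ℝ (Fin d) → EuclideanSpace ℝ (Fin p)},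
      (∀ z, m' z = WithLp.toLp 2
        (-((γᵀ * momentMatrix P (Z 0) (Z 0) * γ)⁻¹ * γᵀ) *ᵥ z.ofLp)) →
      TendstoInDistribution D atTop m' (fun _ => P)
        (multivariateGaussian 0 ((∫ ω, ε 0 ω ^ 2 ∂P) • momentMatrix P (Z 0) (Z 0))) →
      TendstoInDistribution D atTop
        (id : EuclideanSpace ℝ (Fin p) → EuclideanSpace ℝ (Fin p)) (fun _ => P)
        (multivariateGaussian 0
          ((∫ ω, ε 0 ω ^ 2 ∂P) • (γᵀ * momentMatrix P (Z 0) (Z 0) * γ)⁻¹)) := by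
    intro D m' hm' hD
    refine ⟨hD.forall_aemeasurable, aemeasurable_id, ?_⟩
    have hlim := hD.tendsto
    simp only [funext hm', hmodel.map_argmin_zero] at hlim
    simpa only [Measure.map_id] using hlim
  refine ⟨⟨m, hm.measurable, fun z δ => ⟨fun hδ => ?_, ?_⟩, hdrive⟩,
    fun hρ' => hgauss (hm0 hρ') hdrive, ?_⟩
  · by_contra hne
    exact absurd (hδ (m z)) (not_le.2 (hlt z δ hne))
  · rintro rfl δ'
    rcases eq_or_ne δ' (m z) with rfl | hne
    · exact le_rfl
    · exact (hlt z δ' hne).le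
  -- TSLS is treated with `ρn = 0`; the eigenvalue condition for 0 follows from `0 ≤ ρ ≤ λ_p`.
  · obtain ⟨m', hm', hlt', hm0'⟩ :=
      hmodel.exists_continuous_argmin hp le_rfl (hρ0.trans hle)
    refine hgauss (hm0' rfl) (hmodel.tendstoInDistribution_of_isDriveEstimate (ρn := fun _ => 0)
      (fun _ => le_rfl) tendsto_const_nhds hm' hlt' (fun n => ?_) ?_)
    · have hX := hmodel.measurable_X
      have hY := hmodel.measurable_Y
      have hZ := hmodel.measurable_Z
      refine (measurable_tslsEstimate (fun i j => ?_) (fun i => ?_) fun i j => ?_).aemeasurable <;>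
        simp only [dataMatrix, dataVector, Matrix.of_apply] <;> fun_prop
    · filter_upwards [hmodel.eventually_isUnit_det, hmodel.eventually_isUnit_det_secondStage]
        with ω h1 h2
      filter_upwards [h1, h2] with n g1 g2 using isDriveEstimate_tslsEstimate _ g1 g2
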